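/- Let $d\ge 3$ be an integer and $\lambda>\lambda_c(d):=\frac{(d-1)^{d-1}}{(d-2)^d}$. Let $\hat{\mathbb T}$ be the infinite rooted $(d-1)$-ary tree with root $\rho$, in which every vertex has $d-1$ children. Recall that the hardcore measure with fugacity $\lambda$ on a finite graph gives each independent set $\sigma$ (viewed as a $0/1$ configuration, $1$ meaning occupied) probability proportional to $\lambda^{|\sigma|}$. For $n\ge 0$ let $\nu_n$ be the hardcore measure with fugacity $\lambda$ on the levels $0,\dots,n$ of $\hat{\mathbb T}$, conditioned on every vertex of level $n$ being occupied, viewed as a measure on $\{0,1\}^{\hat{\mathbb T}}$ (vertices below level $n$ being set to $0$, say). Let $\hat\mu_+$ and $\hat\mu_-$ be the weak limits, as $k\to\infty$, of $\nu_{2k}$ and $\nu_{2k+1}$ respectively (the extremal semi-translation-invariant hardcore measures on $\hat{\mathbb T}$), and for $s\in\{+,-\}$ put $q^s=\hat\mu_s(\sigma_\rho=1)$. For $\ell\ge 0$ let $X_{\rho,\ell,s}$ be the posterior probability that the root is occupied given the configuration on level $\ell$, that is, $X_{\rho,\ell,s}=h_{\ell}^s(\sigma_{S_\ell})$ where $\sigma\sim\hat\mu_s$,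 $\sigma_{S_\ell}$ is the restriction of $\sigma$ to the set $S_\ell$ of vertices of level $\ell$, and $h^s_\ell(A)=\hat\mu_s(\sigma_\rho=1\mid\sigma_{S_\ell}=A)$. The weak limits $\hat\mu_\pm$ exist. If moreover $q^+\le \frac35$ and $q^+q^-<\frac1{d-1}$, then there are constants $\zeta_1,\zeta_2>0$ (depending only on $\lambda$ and $d$) such that for each $s\in\{+,-\}$ and for all sufficiently large $\ell$, $$\hat\mu_s\left(|X_{\rho,\ell,s}-q^s|\ge e^{-\zeta_1\ell}\right)\le \exp\left(-e^{\zeta_2\ell}\right).$$ -/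

import Mathlib

open MeasureTheory ProbabilityTheory Filter Topology

/-! ### The hardcore model on a finite graph -/

open Classical in
/-- The weight `lam ^ |σ|` of a configuration `σ ∈ {0,1}^V` if its set of occupied vertices is
independent in `G`, and `0` otherwise. -/
noncomputable def hardcoreWeight {V : Type*} [Fintype V] (G : SimpleGraph V) (lam : ℝ)
    (σ : V → Bool) : ℝ :=
  if G.IsIndepSet {v | σ v = true} then
    lam ^ (Finset.univ.filter (fun v => σ v = true)).card
  else 0

/-- The partition function. -/
noncomputable def partitionFunction {V : Type*} [Fintype V] [DecidableEq V] (G : SimpleGraph V)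
    (lam : ℝ) : ℝ :=
  ∑ σ : V → Bool, hardcoreWeight G lam σ

/-- The hardcore measure on `{0,1}^V` with fugacity `lam`. -/
noncomputable def hardcoreMeasure {V : Type*} [Fintype V] [DecidableEq V] (G : SimpleGraph V) (lam : ℝ) :
    Measure (V → Bool) :=
  ∑ σ : V → Bool,
    ENNReal.ofReal (hardcoreWeight G lam σ / partitionFunction G lam) • Measure.dirac σ

/-! ### The infinite `b`-ary tree -/

/-- The rooted infinite `b`-ary tree: the vertices are the finite words over `Fin b`, the root is
the empty word, the children of `v` are the words `a :: v`, and the level of `v` is its length. -/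
def aryTree (b : ℕ) : SimpleGraph (List (Fin b)) where
  Adj u v := (∃ a, v = a :: u) ∨ (∃ a, u = a :: v)
  symm := ⟨fun _ _ h => h.symm⟩
  loopless := ⟨fun u h => by
    rcases h with ⟨a, h⟩ | ⟨a, h⟩ <;> exact absurd (congrArg List.length h) (by simp)⟩

/-- The vertices of the `b`-ary tree on the levels `0, …, n`. -/
abbrev TruncVertex (b n : ℕ) : Type := {v : List (Fin b) // v.length ≤ n}

instance truncVertexFinite (b n : ℕ) : Finite (TruncVertex b n) :=
  (List.finite_length_le (Fin b) n).to_subtype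

noncomputable instance truncVertexFintype (b n : ℕ) : Fintype (TruncVertex b n) :=
  Fintype.ofFinite _

/-- The subgraph of the `b`-ary tree induced by the levels `0, …, n`. -/
def truncTree (b n : ℕ) : SimpleGraph (TruncVertex b n) :=
  (aryTree b).comap Subtype.val

/-- Configurations on the infinite `b`-ary tree (`true` means occupied). -/
abbrev TreeConfig (b : ℕ) : Type := List (Fin b) → Bool

/-- Extension of a configuration on the first `n` levels by unoccupied vertices. -/
def extendConfig {b n : ℕ} (σ : TruncVertex b n → Bool) : TreeConfig b :=
  fun v => if h : v.length ≤ n then σ ⟨v, h⟩ else false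

/-- The hardcore measure on the first `n` levels of the `b`-ary tree, conditioned on level `n`
being completely occupied, as a measure on the configurations of the infinite tree. -/
noncomputable def occupiedBoundaryMeasure (b : ℕ) (lam : ℝ) (n : ℕ) :
    FiniteMeasure (TreeConfig b) :=
  ⟨((hardcoreMeasure (truncTree b n) lam)[|{σ | ∀ v : TruncVertex b n,
      v.1.length = n → σ v = true}]).map extendConfig, inferInstance⟩

/-! ### The extremal semi-translation-invariant measures on the `(d-1)`-ary tree -/

/-- The two phases `+` and `-`. -/
inductive Phase where
  | plus
  | minus

/-- The levels that are conditioned to be occupied: even ones for `+`, odd ones for `-`. -/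
def Phase.level : Phase → ℕ → ℕ
  | .plus, k => 2 * k
  | .minus, k => 2 * k + 1

/-- The extremal semi-translation-invariant hardcore measure of phase `s` on the `(d-1)`-ary tree:
the weak limit, as `k → ∞`, of the hardcore measure conditioned on level `2k` (for `+`) or
`2k+1` (for `-`) being completely occupied. -/
noncomputable def extremalMeasure (d : ℕ) (lam : ℝ) (s : Phase) :
    FiniteMeasure (TreeConfig (d - 1)) :=
  limUnder atTop (fun k : ℕ => occupiedBoundaryMeasure (d - 1) lam (s.level k))

/-- The occupation density `q^s` of the root. -/
noncomputable def rootDensity (d : ℕ) (lam : ℝ) (s : Phase) : ℝ :=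
  (extremalMeasure d lam s : Measure (TreeConfig (d - 1))).real {σ | σ [] = true}

/-- The posterior probability that the root is occupied, given that the configuration on level `ℓ`
is `A`, under the extremal measure of phase `s`. -/
noncomputable def posterior (d : ℕ) (lam : ℝ) (s : Phase) (ℓ : ℕ)
    (A : {v : List (Fin (d - 1)) // v.length = ℓ} → Bool) : ℝ :=
  ((extremalMeasure d lam s : Measure (TreeConfig (d - 1)))[|{τ | ∀ v, τ v.1 = A v}]).real
    {τ | τ [] = true}

/-- The random variable `X_{ρ,ℓ,s}`: the posterior evaluated at the restriction of the random
configuration `σ` to level `ℓ`. -/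
noncomputable def rootPosterior (d : ℕ) (lam : ℝ) (s : Phase) (ℓ : ℕ)
    (σ : TreeConfig (d - 1)) : ℝ :=
  posterior d lam s ℓ (fun v => σ v.1)

/-- The uniqueness threshold `λ_c(d) = (d-1)^(d-1) / (d-2)^d` of the `d`-regular tree. -/
noncomputable def criticalFugacity (d : ℕ) : ℝ :=
  ((d : ℝ) - 1) ^ (d - 1) / ((d : ℝ) - 2) ^ d

/-! Write b = d - 1. All measures involved are tree-indexed Markov chains built from independent
uniform labels: a vertex is occupied iff its label is below the density of its level and its parent
is empty. For the conditioned hardcore measures the densities are the iterates of x ↦ λ(1-x)^b / (1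
+ λ(1-x)^b) started at 1 (`occupiedBoundaryMeasure_eq`). This map is decreasing, so the even and the
odd iterates are monotone and converge to a two-cycle (q⁺, q⁻); coupling through common labels turns
convergence of the densities into weak convergence of the measures.

For λ > λ_c the value 1/b separates q⁻ from q⁺, and comparing the logarithmic mean with the
geometric and arithmetic means gives b² q⁺ q⁻ < 1 (`isPhasePair`, `sq_mul_lt_one`). This inequality
serves twice. A change of the root spin reaches level ℓ only along a path of small labels, and the
expected number of such paths decays like (b² q⁺ q⁻)^(ℓ/2); hence the posterior tends to q^s in
probability (`exists_forall_phaseRooted_post_le`). And in the coordinate -log(1-x) the posterior is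
a function of the sum over the children whose slope at the fixed point is q^s, so with suitable
weights the recursion contracts near the densities (`exists_isContraction`).

The doubly exponential rate comes from a bootstrap. That slope is below 1 everywhere, so one bad
subtree k levels down cannot spoil the root when all the others are good: a bad root forces two bad
descendants (`exists_badSet_subset`). By conditional independence the probability of being bad then
satisfies p' ≤ D p², and it starts small, so it decays like exp(-2^j) (`exists_badSet_le_exp`).
Finally about half of the levels are spent on this squaring and the others on the contraction
(`exists_rates`). -/

namespace HardcoreTree

/-! ### Spin systems on the tree generated from independent uniform variables -/

variable {b : ℕ}

/-- A family of uniform labels of the vertices. -/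
abbrev Labels (b : ℕ) : Type := List (Fin b) → unitInterval

/-- The law of independent uniform labels. -/
noncomputable abbrev labelLaw (b : ℕ) : Measure (Labels b) :=
  Measure.infinitePi fun _ => volume

/-- The configuration with spin `x` at the root, in which a vertex `v` below the root is occupied
iff its label is smaller than `ρ |v|` and its parent is unoccupied. -/
noncomputable def genFrom (ρ : ℕ → unitInterval) (x : Bool) (U : Labels b) : TreeConfig b
  | [] => x
  | a :: u => decide (U (a :: u) < ρ (u.length + 1)) && !genFrom ρ x U u

/-- The configuration whose root is occupied iff its label is smaller than `ρ 0`. -/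
noncomputable def gen (ρ : ℕ → unitInterval) (U : Labels b) : TreeConfig b :=
  genFrom ρ (decide (U [] < ρ 0)) U

/-- The tree-indexed Markov chain with densities `ρ`. -/
noncomputable def markov (b : ℕ) (ρ : ℕ → unitInterval) : Measure (TreeConfig b) :=
  (labelLaw b).map (gen ρ)

/-- The tree-indexed Markov chain with densities `ρ`, started from the spin `x`. -/
noncomputable def rooted (b : ℕ) (ρ : ℕ → unitInterval) (x : Bool) : Measure (TreeConfig b) :=
  (labelLaw b).map (genFrom ρ x)

/-- The restriction of a family to the subtree of the child `a` of the root. -/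
def sub {β : Type*} (a : Fin b) (f : List (Fin b) → β) : List (Fin b) → β := fun v => f (v ++ [a])

lemma measurable_sub {β : Type*} [MeasurableSpace β] (a : Fin b) :
    Measurable (sub a : (List (Fin b) → β) → _) :=
  measurable_pi_lambda _ fun _ => measurable_pi_apply _

lemma measurable_decide_lt (v : List (Fin b)) (c : unitInterval) :
    Measurable fun U : Labels b => decide (U v < c) := by
  apply measurable_to_bool
  have : (fun U : Labels b => decide (U v < c)) ⁻¹' {true} = (fun U => U v) ⁻¹' Set.Iio c := by
    ext; simp
  rw [this]
  exact measurable_pi_apply v measurableSet_Iio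

lemma measurable_genFrom (ρ : ℕ → unitInterval) (x : Bool) :
    Measurable (genFrom ρ x : Labels b → _) := by
  rw [measurable_pi_iff]
  intro v
  induction v with
  | nil => exact measurable_const
  | cons a u ih =>
    have := (measurable_decide_lt (a :: u) (ρ (u.length + 1))).prodMk ih
    exact (measurable_of_countable fun p : Bool × Bool => p.1 && !p.2).comp this

lemma gen_eq_ite (ρ : ℕ → unitInterval) (U : Labels b) :
    gen ρ U = if U [] < ρ 0 then genFrom ρ true U else genFrom ρ false U := by
  unfold gen; split_ifs with h <;> simp [h]

lemma measurable_gen (ρ : ℕ → unitInterval) : Measurable (gen ρ : Labels b → _) := by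
  have : (gen ρ : Labels b → _) =
      fun U => if U [] < ρ 0 then genFrom ρ true U else genFrom ρ false U := by
    ext1 U; exact gen_eq_ite ρ U
  rw [this]
  exact Measurable.ite (measurable_pi_apply (X := fun _ => unitInterval) ([] : List (Fin b)) measurableSet_Iio)
    (measurable_genFrom ρ true) (measurable_genFrom ρ false)

instance (ρ : ℕ → unitInterval) : IsProbabilityMeasure (markov b ρ) :=
  Measure.isProbabilityMeasure_map (measurable_gen ρ).aemeasurable

instance (ρ : ℕ → unitInterval) (x : Bool) : IsProbabilityMeasure (rooted b ρ x) :=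
  Measure.isProbabilityMeasure_map (measurable_genFrom ρ x).aemeasurable

/-! ### Decomposition of the labels and of the chain at the root. -/

/-- The family with value `p.1` at the root and `p.2 a` on the subtree of the child `a`. -/
def glue {β : Type*} (p : β × (Fin b → List (Fin b) → β)) : List (Fin b) → β :=
  fun v => if h : v = [] then p.1 else p.2 (v.getLast h) v.dropLast

@[simp] lemma glue_nil {β : Type*} (p : β × (Fin b → List (Fin b) → β)) : glue p [] = p.1 := by
  simp [glue]

@[simp] lemma glue_append {β : Type*} (p : β × (Fin b → List (Fin b) → β)) (v : List (Fin b))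
    (a : Fin b) : glue p (v ++ [a]) = p.2 a v := by
  simp [glue]

lemma measurable_glue {β : Type*} [MeasurableSpace β] :
    Measurable (glue : β × (Fin b → List (Fin b) → β) → _) := by
  rw [measurable_pi_iff]
  intro v
  rcases List.eq_nil_or_concat' v with rfl | ⟨w, a, rfl⟩
  · simpa using measurable_fst
  · simp only [glue_append]
    exact (measurable_pi_apply _).comp ((measurable_pi_apply _).comp measurable_snd)

/-- Words grow at their head, so the last letter of a nonempty word names the child of the root
below which it lies. Splitting by the last letter splits the product measure into the root label and
`b` independent copies, which yields all independence statements for the chain. -/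
lemma labelLaw_eq_map_glue :
    ((volume : Measure unitInterval).prod (Measure.pi fun _ : Fin b => labelLaw b)).map glue =
      labelLaw b := by
  classical
  refine Measure.eq_infinitePi _ fun s t ht => ?_
  set t' : List (Fin b) → Set unitInterval := fun v => if v ∈ s then t v else Set.univ with ht'
  have mt' : ∀ v, MeasurableSet (t' v) := fun v => by
    simp only [ht']; split_ifs; exacts [ht v, .univ]
  -- The index set is enlarged to the root together with a full product of children and words, with
  -- trivial constraints at the added vertices, so that the box factors.
  set B := s.image List.dropLast
  set S : Finset (List (Fin b)) :=
    insert [] (((Finset.univ : Finset (Fin b)) ×ˢ B).image fun p => p.2 ++ [p.1]) with hS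
  have hsS : s ⊆ S := by
    intro v hv
    rcases List.eq_nil_or_concat' v with rfl | ⟨w, a, rfl⟩
    · simp [hS]
    · refine Finset.mem_insert_of_mem (Finset.mem_image.2 ⟨(a, w), ?_, rfl⟩)
      simp only [Finset.mem_product, Finset.mem_univ, true_and]
      exact Finset.mem_image.2 ⟨_, hv, by simp⟩
  have hpi : Set.pi (s : Set (List (Fin b))) t = Set.pi (S : Set (List (Fin b))) t' := by
    ext U
    simp only [Set.mem_pi, Finset.mem_coe, ht']
    constructor
    · intro h v _
      split_ifs with hv
      · exact h v hv
      · trivial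
    · intro h v hv
      simpa [hv] using h v (hsS hv)
  have hprod : ∏ v ∈ s, volume (t v) = ∏ v ∈ S, volume (t' v) := by
    rw [← Finset.prod_subset hsS (f := fun v => volume (t' v))]
    · exact Finset.prod_congr rfl fun v hv => by simp [ht', hv]
    · intro v _ hv
      simp [ht', hv]
  have hpre : glue ⁻¹' (Set.pi (S : Set (List (Fin b))) t') =
      t' [] ×ˢ Set.univ.pi fun a : Fin b =>
        Set.pi (B : Set (List (Fin b))) fun w => t' (w ++ [a]) := by
    ext ⟨u, V⟩
    simp only [Set.mem_preimage, Set.mem_pi, Finset.mem_coe, hS, Finset.mem_insert,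
      Finset.mem_image, Finset.mem_product, Finset.mem_univ, true_and, Set.mem_prod,
      forall_eq_or_imp, glue_nil, and_congr_right_iff]
    intro _
    constructor
    · intro h a _ w hw
      simpa using h (w ++ [a]) ⟨(a, w), hw, rfl⟩
    · rintro h _ ⟨⟨a, w⟩, hw, rfl⟩
      simpa using h a trivial w hw
  rw [Measure.map_apply measurable_glue (by
      rw [hpi]; exact MeasurableSet.pi S.countable_toSet fun v _ => mt' v), hprod, hpi, hpre,
    Measure.prod_prod, Measure.pi_pi, hS, Finset.prod_insert (by simp), Finset.prod_image]
  · rw [Finset.prod_product]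
    congr 1
    refine Finset.prod_congr rfl fun a _ => ?_
    rw [Measure.infinitePi_pi _ fun w _ => mt' _]
  · rintro ⟨a, v⟩ _ ⟨a', v'⟩ _ h
    have := List.append_inj' h rfl
    simp_all

/-- Once the root spin is prescribed the root label is never read; this makes it independent of the
configuration in `labelLaw_root_inter`. -/
lemma genFrom_glue (ρ : ℕ → unitInterval) (x : Bool) (u u' : unitInterval)
    (V : Fin b → Labels b) : genFrom ρ x (glue (u, V)) = genFrom ρ x (glue (u', V)) := by
  funext v
  induction v with
  | nil => rfl
  | cons a v ih => simp only [genFrom, ih]; rfl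

lemma sub_genFrom_true (ρ : ℕ → unitInterval) (u : unitInterval) (V : Fin b → Labels b)
    (a : Fin b) : sub a (genFrom ρ true (glue (u, V))) = genFrom (fun j => ρ (j + 1)) false (V a) := by
  funext v
  induction v with
  | nil => simp [sub, genFrom]
  | cons c v ih =>
    simp only [sub] at ih ⊢
    rw [List.cons_append, genFrom, genFrom, ih, ← List.cons_append, glue_append]
    simp

lemma sub_genFrom_false (ρ : ℕ → unitInterval) (u : unitInterval) (V : Fin b → Labels b)
    (a : Fin b) : sub a (genFrom ρ false (glue (u, V))) = gen (fun j => ρ (j + 1)) (V a) := by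
  funext v
  unfold gen
  induction v with
  | nil =>
    have : glue (u, V) [a] = V a [] := glue_append (u, V) [] a
    simp [sub, genFrom, this]
  | cons c v ih =>
    simp only [sub] at ih ⊢
    rw [List.cons_append, genFrom, genFrom, ih, ← List.cons_append, glue_append]
    simp

lemma measurableSet_forall_sub {E : Fin b → Set (TreeConfig b)} (hE : ∀ a, MeasurableSet (E a)) :
    MeasurableSet {σ : TreeConfig b | ∀ a, sub a σ ∈ E a} := by
  have : {σ : TreeConfig b | ∀ a, sub a σ ∈ E a} = ⋂ a, sub a ⁻¹' E a := by ext; simp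
  rw [this]
  exact MeasurableSet.iInter fun a => measurable_sub a (hE a)

/-- Below an occupied root the subtrees are independent and their roots are unoccupied. -/
lemma rooted_true_forall_sub (ρ : ℕ → unitInterval) {E : Fin b → Set (TreeConfig b)}
    (hE : ∀ a, MeasurableSet (E a)) :
    (rooted b ρ true).real {σ | ∀ a, sub a σ ∈ E a} =
      ∏ a, (rooted b (fun j => ρ (j + 1)) false).real (E a) := by
  have h := measurable_genFrom (b := b) ρ true
  simp only [Measure.real, rooted]
  rw [Measure.map_apply h (measurableSet_forall_sub hE), ← labelLaw_eq_map_glue,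
    Measure.map_apply measurable_glue (h (measurableSet_forall_sub hE))]
  have : glue ⁻¹' (genFrom ρ true ⁻¹' {σ : TreeConfig b | ∀ a, sub a σ ∈ E a}) =
      (Set.univ : Set unitInterval) ×ˢ
        Set.univ.pi fun a => genFrom (fun j => ρ (j + 1)) false ⁻¹' E a := by
    ext ⟨u, V⟩
    simp [sub_genFrom_true]
  rw [this, Measure.prod_prod, Measure.pi_pi, measure_univ, one_mul, ENNReal.toReal_prod]
  refine Finset.prod_congr rfl fun a _ => ?_
  rw [labelLaw_eq_map_glue, Measure.map_apply (measurable_genFrom _ _) (hE a)]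

/-- Below an unoccupied root the subtrees are independent Markov chains. -/
lemma rooted_false_forall_sub (ρ : ℕ → unitInterval) {E : Fin b → Set (TreeConfig b)}
    (hE : ∀ a, MeasurableSet (E a)) :
    (rooted b ρ false).real {σ | ∀ a, sub a σ ∈ E a} =
      ∏ a, (markov b (fun j => ρ (j + 1))).real (E a) := by
  have h := measurable_genFrom (b := b) ρ false
  simp only [Measure.real, rooted, markov]
  rw [Measure.map_apply h (measurableSet_forall_sub hE), ← labelLaw_eq_map_glue,
    Measure.map_apply measurable_glue (h (measurableSet_forall_sub hE))]
  have : glue ⁻¹' (genFrom ρ false ⁻¹' {σ : TreeConfig b | ∀ a, sub a σ ∈ E a}) =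
      (Set.univ : Set unitInterval) ×ˢ
        Set.univ.pi fun a => gen (fun j => ρ (j + 1)) ⁻¹' E a := by
    ext ⟨u, V⟩
    simp [sub_genFrom_false]
  rw [this, Measure.prod_prod, Measure.pi_pi, measure_univ, one_mul, ENNReal.toReal_prod]
  refine Finset.prod_congr rfl fun a _ => ?_
  rw [labelLaw_eq_map_glue, Measure.map_apply (measurable_gen _) (hE a)]

lemma labelLaw_root_inter (ρ : ℕ → unitInterval) (x : Bool) {I : Set unitInterval}
    (hI : MeasurableSet I) {E : Set (TreeConfig b)} (hE : MeasurableSet E) :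
    labelLaw b {U | U [] ∈ I ∧ genFrom ρ x U ∈ E} = volume I * rooted b ρ x E := by
  have h := measurable_genFrom (b := b) ρ x
  have key : ∀ J : Set unitInterval, MeasurableSet J →
      labelLaw b {U | U [] ∈ J ∧ genFrom ρ x U ∈ E} =
        volume J * (Measure.pi fun _ : Fin b => labelLaw b)
          {V | genFrom ρ x (glue (0, V)) ∈ E} := by
    intro J hJ
    have hm : MeasurableSet {U : Labels b | U [] ∈ J ∧ genFrom ρ x U ∈ E} :=
      (measurable_pi_apply (X := fun _ => unitInterval) ([] : List (Fin b)) hJ).inter (h hE)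
    conv_lhs => rw [← labelLaw_eq_map_glue]
    rw [Measure.map_apply measurable_glue hm]
    have : glue ⁻¹' {U : Labels b | U [] ∈ J ∧ genFrom ρ x U ∈ E} =
        J ×ˢ {V | genFrom ρ x (glue (0, V)) ∈ E} := by
      ext ⟨u, V⟩
      simp [genFrom_glue ρ x u 0]
    rw [this, Measure.prod_prod]
  -- The case of a trivial root constraint identifies the second factor with the law of the chain
  -- started from `x`.
  have h1 := key Set.univ .univ
  rw [measure_univ, one_mul] at h1
  rw [key I hI, ← h1, rooted, Measure.map_apply h hE]
  simp [Set.preimage]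

/-- The Markov chain is a mixture over the spin of the root. -/
lemma markov_real_eq (ρ : ℕ → unitInterval) {E : Set (TreeConfig b)} (hE : MeasurableSet E) :
    (markov b ρ).real E =
      (1 - ρ 0) * (rooted b ρ false).real E + ρ 0 * (rooted b ρ true).real E := by
  have h0 := labelLaw_root_inter ρ false (I := Set.Ici (ρ 0)) measurableSet_Ici hE
  have h1 := labelLaw_root_inter ρ true (I := Set.Iio (ρ 0)) measurableSet_Iio hE
  have hu : gen ρ ⁻¹' E = {U : Labels b | U [] ∈ Set.Ici (ρ 0) ∧ genFrom ρ false U ∈ E} ∪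
      {U : Labels b | U [] ∈ Set.Iio (ρ 0) ∧ genFrom ρ true U ∈ E} := by
    ext U
    by_cases h : U [] < ρ 0
    · simp [gen_eq_ite, h]
    · simp [gen_eq_ite, h, not_lt.1 h]
  have hd : Disjoint {U : Labels b | U [] ∈ Set.Ici (ρ 0) ∧ genFrom ρ false U ∈ E}
      {U : Labels b | U [] ∈ Set.Iio (ρ 0) ∧ genFrom ρ true U ∈ E} := by
    rw [Set.disjoint_left]
    rintro U ⟨h, _⟩ ⟨h', _⟩
    exact not_lt.2 (Set.mem_Ici.1 h) (Set.mem_Iio.1 h')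
  have hm : MeasurableSet {U : Labels b | U [] ∈ Set.Iio (ρ 0) ∧ genFrom ρ true U ∈ E} :=
    (measurable_pi_apply (X := fun _ => unitInterval) ([] : List (Fin b)) measurableSet_Iio).inter
      (measurable_genFrom ρ true hE)
  rw [Measure.real, markov, Measure.map_apply (measurable_gen ρ) hE, hu, measure_union hd hm, h0, h1,
    ENNReal.toReal_add (by finiteness) (by finiteness), ENNReal.toReal_mul, ENNReal.toReal_mul,
    unitInterval.volume_Ici, unitInterval.volume_Iio,
    ENNReal.toReal_ofReal (by linarith [(ρ 0).2.2]), ENNReal.toReal_ofReal (ρ 0).2.1]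
  rfl

lemma rooted_real_root (ρ : ℕ → unitInterval) (x : Bool) (E : Set (TreeConfig b)) :
    (rooted b ρ x).real ({σ | σ [] = x} ∩ E) = (rooted b ρ x).real E := by
  have hc : (rooted b ρ x) {σ | σ [] = x}ᶜ = 0 := by
    have hm : MeasurableSet {σ : TreeConfig b | σ [] = x} :=
      measurable_pi_apply (X := fun _ => Bool) ([] : List (Fin b)) (measurableSet_singleton x)
    rw [rooted, Measure.map_apply (measurable_genFrom ρ x) hm.compl]
    convert measure_empty (μ := labelLaw b)
    ext U
    simp [genFrom]
  simp only [Measure.real]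
  congr 1
  rw [Set.inter_comm]
  exact measure_inter_conull hc

/-! ### Weak convergence -/

/-- The spin of a vertex depends only on the root spin and on finitely many comparisons of labels
with densities, so it is eventually constant once each comparison is. -/
lemma tendsto_genFrom {ρn : ℕ → ℕ → unitInterval} {ρ : ℕ → unitInterval} {U : Labels b}
    {xn : ℕ → Bool} {x : Bool} (hx : ∀ᶠ k in atTop, xn k = x)
    (hU : ∀ v, ∀ᶠ k in atTop, (U v < ρn k v.length ↔ U v < ρ v.length)) :
    Tendsto (fun k => genFrom (ρn k) (xn k) U) atTop (𝓝 (genFrom ρ x U)) := by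
  rw [tendsto_pi_nhds]
  intro v
  apply tendsto_nhds_of_eventually_eq
  induction v with
  | nil => simpa [genFrom] using hx
  | cons a u ih =>
    filter_upwards [ih, hU (a :: u)] with k h1 h2
    simp only [List.length_cons] at h2
    simp [genFrom, h1, h2]

lemma ae_label_ne (ρ : ℕ → unitInterval) :
    ∀ᵐ U ∂labelLaw b, ∀ v, U v ≠ ρ v.length := by
  rw [ae_all_iff]
  intro v
  have := (measurePreserving_eval_infinitePi (fun _ : List (Fin b) => (volume : Measure unitInterval)) v)
  have h2 : ∀ᵐ u ∂(volume : Measure unitInterval), u ≠ ρ v.length := by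
    simp [ae_iff]
  exact this.quasiMeasurePreserving.ae h2

/-- All chains are coupled through the same labels. Almost surely no label equals a limiting
density, so the configurations converge almost surely and dominated convergence applies. -/
lemma tendsto_integral_markov {ρn : ℕ → ℕ → unitInterval} {ρ : ℕ → unitInterval}
    (h : ∀ j, Tendsto (fun k => ρn k j) atTop (𝓝 (ρ j)))
    (f : BoundedContinuousFunction (TreeConfig b) ℝ) :
    Tendsto (fun k => ∫ σ, f σ ∂markov b (ρn k)) atTop (𝓝 (∫ σ, f σ ∂markov b ρ)) := by
  have hm : ∀ ρ : ℕ → unitInterval,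
      ∫ σ, f σ ∂markov b ρ = ∫ U, f (gen ρ U) ∂labelLaw b := fun ρ =>
    integral_map (measurable_gen ρ).aemeasurable f.continuous.measurable.aestronglyMeasurable
  simp only [hm]
  refine tendsto_integral_of_dominated_convergence (fun _ => ‖f‖)
    (fun k => (f.continuous.measurable.comp (measurable_gen _)).aestronglyMeasurable)
    (integrable_const _) (fun k => ae_of_all _ fun U => f.norm_coe_le_norm _) ?_
  filter_upwards [ae_label_ne (b := b) ρ] with U hU
  have hlt : ∀ v, ∀ᶠ k in atTop, (U v < ρn k v.length ↔ U v < ρ v.length) := by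
    intro v
    rcases lt_or_gt_of_ne (hU v) with h1 | h1
    · filter_upwards [(h v.length).eventually (lt_mem_nhds h1)] with k hk
      simp [hk, h1]
    · filter_upwards [(h v.length).eventually (gt_mem_nhds h1)] with k hk
      exact iff_of_false hk.not_gt h1.not_gt
  refine (f.continuous.tendsto _).comp (tendsto_genFrom ?_ hlt)
  filter_upwards [hlt []] with k hk
  simpa using hk

/-! ### Levels -/

/-- The vertices of level `m`. -/
def lev (b : ℕ) : ℕ → Finset (List (Fin b))
  | 0 => {[]}
  | m + 1 => ((Finset.univ : Finset (Fin b)) ×ˢ lev b m).map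
      ⟨fun p => p.1 :: p.2, fun p q h => by simpa [Prod.ext_iff] using h⟩

@[simp] lemma mem_lev {m : ℕ} {v : List (Fin b)} : v ∈ lev b m ↔ v.length = m := by
  induction m generalizing v with
  | zero => simp [lev]
  | succ m ih =>
    cases v with
    | nil => simp [lev]
    | cons a u =>
      simp only [lev, Finset.mem_map, Finset.mem_product, Finset.mem_univ, true_and, ih,
        List.length_cons, Nat.add_right_cancel_iff, Prod.exists]
      exact ⟨by rintro ⟨a, u, h, h2⟩; cases h2; exact h, fun h => ⟨_, _, h, rfl⟩⟩

lemma prod_lev_succ {M : Type*} [CommMonoid M] (m : ℕ) (f : List (Fin b) → M) :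
    ∏ v ∈ lev b (m + 1), f v = ∏ u ∈ lev b m, ∏ a, f (a :: u) := by
  rw [lev, Finset.prod_map, Finset.prod_product_right]
  rfl

lemma card_lev (m : ℕ) : (lev b m).card = b ^ m := by
  induction m with
  | zero => simp [lev]
  | succ m ih => simp [lev, ih, pow_succ, mul_comm]

/-- The vertices on the levels `0, …, n`. -/
def words (b n : ℕ) : Finset (List (Fin b)) := (Finset.range (n + 1)).biUnion (lev b)

@[simp] lemma mem_words {n : ℕ} {v : List (Fin b)} : v ∈ words b n ↔ v.length ≤ n := by
  simp [words]

lemma words_succ (n : ℕ) : words b (n + 1) = words b n ∪ lev b (n + 1) := by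
  ext v; simp; omega

lemma prod_words_succ {M : Type*} [CommMonoid M] (n : ℕ) (f : List (Fin b) → M) :
    ∏ v ∈ words b (n + 1), f v = (∏ v ∈ words b n, f v) * ∏ v ∈ lev b (n + 1), f v := by
  rw [words_succ, Finset.prod_union]
  rw [Finset.disjoint_left]
  intro v; simp; omega

/-! ### Propagation of disagreement -/

/-- The nonempty suffixes of a word. -/
def path : List (Fin b) → Finset (List (Fin b))
  | [] => ∅
  | a :: u => insert (a :: u) (path u)

lemma length_le_of_mem_path {v w : List (Fin b)} (h : w ∈ path v) : w.length ≤ v.length := by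
  induction v with
  | nil => simp [path] at h
  | cons a u ih =>
    rw [path, Finset.mem_insert] at h
    rcases h with rfl | h
    · rfl
    · exact (ih h).trans (by simp)

/-- The path has one vertex on each level from 1 to `v.length`, and their labels are independent;
the root is not among them. -/
lemma labelLaw_open_path (ρ : ℕ → unitInterval) (v : List (Fin b)) :
    (labelLaw b).real {U | ∀ w ∈ path v, U w < ρ w.length} =
      ∏ j ∈ Finset.range v.length, (ρ (j + 1) : ℝ) := by
  have : {U : Labels b | ∀ w ∈ path v, U w < ρ w.length} =
      Set.pi (path v : Set (List (Fin b))) fun w => Set.Iio (ρ w.length) := by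
    ext; simp [Set.mem_pi]
  rw [this, Measure.real, Measure.infinitePi_pi _ fun _ _ => measurableSet_Iio,
    ENNReal.toReal_prod]
  simp only [unitInterval.volume_Iio, ENNReal.toReal_ofReal (ρ _).2.1]
  induction v with
  | nil => simp [path]
  | cons a u ih =>
    have hn : a :: u ∉ path u := fun h => by
      have := length_le_of_mem_path h
      simp at this
    rw [path, Finset.prod_insert hn, ih (by ext; simp [Set.mem_pi]), List.length_cons,
      Finset.prod_range_succ, mul_comm]

/-- A label at or above the density makes its vertex unoccupied whatever the parent is, which stops
every disagreement coming from above. -/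
lemma open_path_of_disagree (ρ : ℕ → unitInterval) (U : Labels b) (v : List (Fin b))
    (h : genFrom ρ true U v ≠ genFrom ρ false U v) : ∀ w ∈ path v, U w < ρ w.length := by
  induction v with
  | nil => simp [path]
  | cons a u ih =>
    have h1 : U (a :: u) < ρ (u.length + 1) := by
      by_contra h1
      simp [genFrom, h1] at h
    have h2 : genFrom ρ true U u ≠ genFrom ρ false U u := by
      intro h2
      simp [genFrom, h2] at h
    intro w hw
    rw [path, Finset.mem_insert] at hw
    rcases hw with rfl | hw
    · simpa using h1
    · exact ih h2 w hw

/-- The influence of the root on level `ℓ`. -/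
lemma rooted_real_sub_le (ρ : ℕ → unitInterval) (ℓ : ℕ) {E : Set (TreeConfig b)}
    (hE : MeasurableSet E)
    (hℓ : ∀ σ τ : TreeConfig b, (∀ v, v.length = ℓ → σ v = τ v) → σ ∈ E → τ ∈ E) (x y : Bool) :
    (rooted b ρ x).real E ≤ (rooted b ρ y).real E +
      (b : ℝ) ^ ℓ * ∏ j ∈ Finset.range ℓ, (ρ (j + 1) : ℝ) := by
  have hne : ∀ U : Labels b, ∀ v, genFrom ρ x U v ≠ genFrom ρ y U v →
      genFrom ρ true U v ≠ genFrom ρ false U v := by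
    intro U v h
    cases x <;> cases y <;> simp_all [eq_comm]
  have hsub : genFrom ρ x ⁻¹' E ⊆ genFrom ρ y ⁻¹' E ∪
      ⋃ v ∈ lev b ℓ, {U : Labels b | ∀ w ∈ path v, U w < ρ w.length} := by
    intro U hU
    by_contra hc
    simp only [Set.mem_union, Set.mem_iUnion, mem_lev, exists_prop, not_or, not_exists,
      not_and] at hc
    refine hc.1 (hℓ _ _ (fun v hv => ?_) hU)
    by_contra h
    exact hc.2 v hv (open_path_of_disagree ρ U v (hne U v h))
  have e : ∀ z, (rooted b ρ z).real E = (labelLaw b).real (genFrom ρ z ⁻¹' E) := fun z => by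
    rw [Measure.real, rooted, Measure.map_apply (measurable_genFrom ρ z) hE]; rfl
  rw [e, e]
  refine (measureReal_mono hsub).trans ((measureReal_union_le _ _).trans ?_)
  gcongr
  -- Union bound over the `b ^ ℓ` possible ends of a path.
  refine (measureReal_biUnion_finset_le _ _).trans ?_
  rw [Finset.sum_congr rfl fun v hv => by rw [labelLaw_open_path, mem_lev.1 hv]]
  simp [card_lev]

/-! ### The conditioned hardcore measures -/

/-- The labels for which `v` gets the spin `τ v`, given that its parent has the right spin. -/
noncomputable def cell (ρ : ℕ → unitInterval) (τ : TreeConfig b) : List (Fin b) → Set unitInterval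
  | [] => if τ [] then Set.Iio (ρ 0) else Set.Ici (ρ 0)
  | a :: u => if τ u then Set.univ else
      if τ (a :: u) then Set.Iio (ρ (u.length + 1)) else Set.Ici (ρ (u.length + 1))

lemma measurableSet_cell (ρ : ℕ → unitInterval) (τ : TreeConfig b) (v : List (Fin b)) :
    MeasurableSet (cell ρ τ v) := by
  cases v with
  | nil => rw [cell]; split_ifs <;> measurability
  | cons a u => rw [cell]; split_ifs <;> measurability

/-- For an independent `τ`, producing `τ` is a product event in the labels: an occupied parent
leaves the label of its child free, since the spin is then forced. -/
lemma gen_eq_on_words_iff (ρ : ℕ → unitInterval) (n : ℕ) {τ : TreeConfig b}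
    (hτ : ∀ a u, τ u = true → τ (a :: u) = false) (U : Labels b) :
    (∀ v ∈ words b n, gen ρ U v = τ v) ↔ ∀ v ∈ words b n, U v ∈ cell ρ τ v := by
  have hg : ∀ a u, gen ρ U (a :: u) =
      (decide (U (a :: u) < ρ (u.length + 1)) && !gen ρ U u) := fun _ _ => rfl
  have hg0 : gen ρ U [] = decide (U [] < ρ 0) := rfl
  constructor
  · intro h v hv
    cases v with
    | nil =>
      have := h [] hv
      rw [hg0] at this
      by_cases h' : U [] < ρ 0 <;> simp_all [cell]
    | cons a u =>
      have h1 := h _ hv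
      have h2 := h u (by simp at hv ⊢; omega)
      rw [hg, h2] at h1
      by_cases h3 : τ u
      · simp [cell, h3]
      · by_cases h' : U (a :: u) < ρ (u.length + 1) <;> simp_all [cell]
  · intro h v hv
    induction v with
    | nil =>
      have := h [] hv
      rw [hg0]
      by_cases h' : τ [] <;> simp_all [cell]
    | cons a u ih =>
      have h1 := h _ hv
      have h2 := ih (by simp at hv ⊢; omega)
      rw [hg, h2]
      by_cases h3 : τ u
      · simp [h3, hτ a u h3]
      · by_cases h' : τ (a :: u) <;> simp_all [cell]

/-- By `hρ` an occupied vertex of level `j` contributes `lam * (1 - ρ (j + 1)) ^ b` besides the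
common factor `1 - ρ j`. The power pays for its `b` children, whose cells have full measure instead
of `1 - ρ (j + 1)`. Level by level these factors cancel and only those of level `m` remain. -/
lemma prod_cell (lam : ℝ) (ρ : ℕ → unitInterval) {τ : TreeConfig b}
    (hτ : ∀ a u, τ u = true → τ (a :: u) = false) (m : ℕ)
    (hρ : ∀ j ≤ m, (ρ j : ℝ) = lam * (1 - ρ (j + 1)) ^ b * (1 - ρ j)) :
    ∏ v ∈ words b m, (volume : Measure unitInterval).real (cell ρ τ v) =
      (∏ v ∈ words b m, (1 - ρ v.length : ℝ)) * (∏ v ∈ words b m, if τ v then lam else 1) *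
        ∏ v ∈ lev b m, if τ v then (1 - (ρ (m + 1) : ℝ)) ^ b else 1 := by
  have hI : ∀ j, (volume : Measure unitInterval).real (Set.Iio (ρ j)) = ρ j := fun j => by
    rw [Measure.real, unitInterval.volume_Iio, ENNReal.toReal_ofReal (ρ j).2.1]
  have hC : ∀ j, (volume : Measure unitInterval).real (Set.Ici (ρ j)) = 1 - ρ j := fun j => by
    rw [Measure.real, unitInterval.volume_Ici, ENNReal.toReal_ofReal (by linarith [(ρ j).2.2])]
  induction m with
  | zero =>
    have : words b 0 = {[]} := by ext; simp
    rw [this]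
    have h0 := hρ 0 le_rfl
    simp only [Finset.prod_singleton, lev, cell, List.length_nil]
    split_ifs
    · rw [hI]; linarith
    · rw [hC]; ring
  | succ m ih =>
    rw [prod_words_succ, prod_words_succ, prod_words_succ, ih fun j hj => hρ j (by omega),
      prod_lev_succ, prod_lev_succ, prod_lev_succ, prod_lev_succ]
    have h0 := hρ (m + 1) le_rfl
    have key : (∏ v ∈ lev b m, if τ v then (1 - (ρ (m + 1) : ℝ)) ^ b else 1) *
        ∏ u ∈ lev b m, ∏ a, (volume : Measure unitInterval).real (cell ρ τ (a :: u)) =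
        (∏ u ∈ lev b m, ∏ a : Fin b, (1 - ρ (a :: u).length : ℝ)) *
        (∏ u ∈ lev b m, ∏ a : Fin b, if τ (a :: u) then lam else 1) *
        ∏ u ∈ lev b m, ∏ a : Fin b, if τ (a :: u) then (1 - (ρ (m + 1 + 1) : ℝ)) ^ b else 1 := by
      simp only [← Finset.prod_mul_distrib]
      refine Finset.prod_congr rfl fun u hu => ?_
      rw [mem_lev] at hu
      by_cases hu1 : τ u
      · have : ∀ a, τ (a :: u) = false := fun a => hτ a u hu1
        simp [hu1, this, cell, hu]
      · simp only [hu1, if_false, one_mul, cell, List.length_cons, hu, Bool.false_eq_true]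
        refine Finset.prod_congr rfl fun a _ => ?_
        split_ifs
        · rw [hI]; linarith
        · rw [hC]; ring
    linear_combination ((∏ v ∈ words b m, (1 - ρ v.length : ℝ)) *
      (∏ v ∈ words b m, if τ v then lam else 1)) * key

/-! ### The occupation probabilities and the law of the conditioned measure. -/

/-- The hardcore recursion for the occupation probability of the root. -/
noncomputable def hcStep (b : ℕ) (lam x : ℝ) : ℝ := lam * (1 - x) ^ b / (1 + lam * (1 - x) ^ b)

lemma hcStep_mem {lam : ℝ} (hlam : 0 < lam) {x : ℝ} (hx : x ≤ 1) :
    hcStep b lam x ∈ Set.Icc (0 : ℝ) 1 := by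
  have : 0 ≤ lam * (1 - x) ^ b := mul_nonneg hlam.le (pow_nonneg (by linarith) _)
  exact ⟨by unfold hcStep; positivity, by unfold hcStep; rw [div_le_one (by linarith)]; linarith⟩

/-- The occupation probability of the root of the `b`-ary tree with occupied level `n`. -/
noncomputable def occ (b : ℕ) (lam : ℝ) : ℕ → unitInterval
  | 0 => 1
  | n + 1 => Set.projIcc 0 1 zero_le_one (hcStep b lam (occ b lam n))

lemma coe_occ_succ {lam : ℝ} (hlam : 0 < lam) (n : ℕ) :
    (occ b lam (n + 1) : ℝ) = hcStep b lam (occ b lam n) := by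
  rw [occ, Set.projIcc_of_mem _ (hcStep_mem hlam (occ b lam n).2.2)]

/-- The densities of the chain whose level `n` is occupied. -/
noncomputable def occDensity (b : ℕ) (lam : ℝ) (n j : ℕ) : unitInterval :=
  if j ≤ n then occ b lam (n - j) else 0

lemma occDensity_eq {lam : ℝ} (hlam : 0 < lam) {n j : ℕ} (hj : j < n) :
    (occDensity b lam n j : ℝ) =
      lam * (1 - occDensity b lam n (j + 1)) ^ b * (1 - occDensity b lam n j) := by
  have h1 : n - j = n - (j + 1) + 1 := by omega
  rw [occDensity, occDensity, if_pos hj.le, if_pos (by omega : j + 1 ≤ n), h1, coe_occ_succ hlam]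
  have h0 : (0 : ℝ) ≤ lam * (1 - occ b lam (n - (j + 1))) ^ b :=
    mul_nonneg hlam.le (pow_nonneg (by linarith [(occ b lam (n - (j + 1))).2.2]) _)
  unfold hcStep
  field_simp
  ring

open Classical in
lemma hardcoreWeight_truncTree (lam : ℝ) (n : ℕ) (σ : TruncVertex b n → Bool) :
    hardcoreWeight (truncTree b n) lam σ =
      if ∀ a u, extendConfig σ u = true → extendConfig σ (a :: u) = false then
        ∏ v ∈ words b n, if extendConfig σ v then lam else 1 else 0 := by
  have hind : (truncTree b n).IsIndepSet {v | σ v = true} ↔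
      ∀ a u, extendConfig σ u = true → extendConfig σ (a :: u) = false := by
    constructor
    · intro h a u hu
      unfold extendConfig at hu ⊢
      split_ifs at hu with hl
      split_ifs with hl'
      · by_contra hc
        have := h (x := ⟨u, hl⟩) hu (y := ⟨a :: u, hl'⟩) (by simpa using hc)
          (fun he => by simpa using congrArg (fun v => v.1.length) he)
        exact this (Or.inl ⟨a, rfl⟩)
      · rfl
    · intro h u hu v hv _ hadj
      have hu' : extendConfig σ u.1 = true := by simpa [extendConfig, u.2] using hu
      have hv' : extendConfig σ v.1 = true := by simpa [extendConfig, v.2] using hv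
      rcases hadj with ⟨a, ha⟩ | ⟨a, ha⟩
      · have := h a u.1 hu'
        rw [← ha, hv'] at this; cases this
      · have := h a v.1 hv'
        rw [← ha, hu'] at this; cases this
  unfold hardcoreWeight
  simp only [hind]
  split_ifs with h
  · have e : (∏ v ∈ words b n, if extendConfig σ v then lam else 1) =
        ∏ v : TruncVertex b n, if σ v then lam else 1 := by
      rw [show (∏ v ∈ words b n, if extendConfig σ v then lam else 1) =
        ∏ v : TruncVertex b n, if extendConfig σ v.1 then lam else 1 from
        Finset.prod_subtype _ (fun v => mem_words) _]
      exact Finset.prod_congr rfl fun v _ => by simp [extendConfig, v.2]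
    rw [e, Finset.prod_ite]
    simp
  · rfl

open Classical in
-- The density of the last level is 1. This kills every configuration with an empty vertex there
-- whose parent is empty, and through the leftover factor of `prod_cell`, which is `0 ^ b`, every
-- configuration with an occupied vertex on level `N`. What survives has its last level full, and
-- the division by a power of `lam` offsets the weight of that level.
lemma prod_cell_occDensity {lam : ℝ} (hlam : 0 < lam) (hb : b ≠ 0) (N : ℕ) {τ : TreeConfig b}
    (hτ : ∀ a u, τ u = true → τ (a :: u) = false) :
    ∏ v ∈ words b (N + 1), (volume : Measure unitInterval).real
        (cell (occDensity b lam (N + 1)) τ v) =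
      (∏ v ∈ words b N, (1 - occDensity b lam (N + 1) v.length : ℝ)) /
          lam ^ (lev b (N + 1)).card *
        if ∀ v, v.length = N + 1 → τ v = true then
          ∏ v ∈ words b (N + 1), if τ v then lam else 1 else 0 := by
  set ρ := occDensity b lam (N + 1) with hρdef
  have hlast : ρ (N + 1) = 1 := by simp [hρdef, occDensity, occ]
  have hroot : ∀ u a, u.length = N → cell ρ τ (a :: u) =
      if τ u then Set.univ else if τ (a :: u) then Set.Iio 1 else Set.Ici 1 := by
    intro u a hu
    rw [cell, hu, hlast]
  rw [prod_words_succ, prod_cell lam ρ hτ N fun j hj => occDensity_eq hlam (by omega)]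
  split_ifs with h
  · have h1 : ∀ u : List (Fin b), u.length = N → τ u = false := by
      intro u hu
      by_contra hc
      have h2 := hτ ⟨0, Nat.pos_of_ne_zero hb⟩ u (by simpa using hc)
      rw [h _ (by simp [hu])] at h2
      cases h2
    have e1 : (∏ v ∈ lev b N, if τ v then (1 - (ρ (N + 1) : ℝ)) ^ b else 1) = 1 :=
      Finset.prod_eq_one fun v hv => by simp [h1 v (mem_lev.1 hv)]
    have e2 : ∏ v ∈ lev b (N + 1), (volume : Measure unitInterval).real (cell ρ τ v) = 1 := by
      rw [prod_lev_succ]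
      refine Finset.prod_eq_one fun u hu => Finset.prod_eq_one fun a _ => ?_
      rw [mem_lev] at hu
      rw [hroot u a hu, h1 u hu, h (a :: u) (by simp [hu])]
      simp [Measure.real]
    have e3 : (∏ v ∈ lev b (N + 1), if τ v then lam else 1) = lam ^ (lev b (N + 1)).card := by
      rw [Finset.prod_congr rfl fun v hv => by rw [if_pos (h v (mem_lev.1 hv))],
        Finset.prod_const]
    rw [e1, e2, prod_words_succ, e3]
    have : lam ^ (lev b (N + 1)).card ≠ 0 := pow_ne_zero _ hlam.ne'
    field_simp
  · rw [mul_zero]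
    push Not at h
    obtain ⟨v, hv, hv0⟩ := h
    cases v with
    | nil => simp at hv
    | cons a u =>
      simp only [List.length_cons, Nat.add_right_cancel_iff] at hv
      by_cases hu : τ u
      · have : (∏ v ∈ lev b N, if τ v then (1 - (ρ (N + 1) : ℝ)) ^ b else 1) = 0 :=
          Finset.prod_eq_zero (mem_lev.2 hv) (by simp [hu, hlast, hb])
        rw [this]; ring
      · have : ∏ v ∈ lev b (N + 1), (volume : Measure unitInterval).real (cell ρ τ v) = 0 := by
          refine Finset.prod_eq_zero (i := a :: u) (mem_lev.2 (by simp [hv])) ?_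
          rw [hroot u a hv]
          simp [hu, hv0, Measure.real]
        rw [this]; ring

/-- The restriction of a configuration to the first levels. -/
def truncate (n : ℕ) (σ : TreeConfig b) : TruncVertex b n → Bool := fun v => σ v.1

lemma measurable_truncate (n : ℕ) : Measurable (truncate n : TreeConfig b → _) :=
  measurable_pi_lambda _ fun _ => measurable_pi_apply _

lemma measurable_extendConfig (n : ℕ) :
    Measurable (extendConfig : (TruncVertex b n → Bool) → TreeConfig b) :=
  measurable_of_countable _

lemma partitionFunction_pos {lam : ℝ} (hlam : 0 < lam) (n : ℕ) :
    0 < partitionFunction (truncTree b n) lam := by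
  have hnn : ∀ σ, 0 ≤ hardcoreWeight (truncTree b n) lam σ := fun σ => by
    unfold hardcoreWeight; split_ifs <;> positivity
  refine Finset.sum_pos' (fun σ _ => hnn σ) ⟨fun _ => false, Finset.mem_univ _, ?_⟩
  unfold hardcoreWeight
  rw [if_pos (by simp)]
  positivity

lemma hardcoreMeasure_singleton {lam : ℝ} (n : ℕ) (σ : TruncVertex b n → Bool) :
    hardcoreMeasure (truncTree b n) lam {σ} =
      ENNReal.ofReal (hardcoreWeight (truncTree b n) lam σ /
        partitionFunction (truncTree b n) lam) := by
  unfold hardcoreMeasure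
  rw [Measure.finsetSum_apply, Finset.sum_eq_single σ]
  · simp
  · intro τ _ h
    simp [h]
  · simp

lemma gen_words_occDensity (lam : ℝ) (n : ℕ) (U : Labels b) :
    extendConfig (truncate n (gen (occDensity b lam n) U)) = gen (occDensity b lam n) U := by
  funext v
  unfold extendConfig truncate
  split_ifs with h
  · rfl
  · cases v with
    | nil => simp at h
    | cons a u =>
      have : occDensity b lam n (u.length + 1) = 0 := by
        rw [occDensity, if_neg (by simpa using h)]
      simp [gen, genFrom, this]

/-- Only proportionality is needed: the constant is recovered afterwards from the total mass. -/
lemma map_truncate_markov_singleton {lam : ℝ} (hlam : 0 < lam) (hb : b ≠ 0) (N : ℕ) :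
    ∃ K : ENNReal, ∀ σ : TruncVertex b (N + 1) → Bool,
      (markov b (occDensity b lam (N + 1))).map (truncate (N + 1)) {σ} =
        K * hardcoreMeasure (truncTree b (N + 1)) lam
          ({σ | ∀ v : TruncVertex b (N + 1), v.1.length = N + 1 → σ v = true} ∩ {σ}) := by
  classical
  set ρ := occDensity b lam (N + 1) with hρ
  set Z := partitionFunction (truncTree b (N + 1)) lam with hZ
  have hZ0 : 0 < Z := partitionFunction_pos hlam _
  set C : ℝ := (∏ v ∈ words b N, (1 - ρ v.length : ℝ)) / lam ^ (lev b (N + 1)).card with hC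
  have hC0 : 0 ≤ C := div_nonneg
    (Finset.prod_nonneg fun v _ => by linarith [(ρ v.length).2.2]) (pow_nonneg hlam.le _)
  refine ⟨ENNReal.ofReal (C * Z), fun σ => ?_⟩
  have hpre : (markov b ρ).map (truncate (N + 1)) {σ} =
      labelLaw b {U | ∀ v ∈ words b (N + 1), gen ρ U v = extendConfig σ v} := by
    rw [Measure.map_apply (measurable_truncate _) (measurableSet_singleton _), markov,
      Measure.map_apply (measurable_gen ρ) (measurable_truncate _ (measurableSet_singleton _))]
    congr 1
    ext U
    simp only [Set.mem_preimage, Set.mem_singleton_iff, Set.mem_ofPred_eq, funext_iff, truncate,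
      mem_words, Subtype.forall]
    refine forall_congr' fun v => forall_congr' fun hv => ?_
    simp [extendConfig, hv]
  have hE : (σ ∈ {σ : TruncVertex b (N + 1) → Bool |
      ∀ v : TruncVertex b (N + 1), v.1.length = N + 1 → σ v = true}) ↔
      ∀ v : List (Fin b), v.length = N + 1 → extendConfig σ v = true := by
    constructor
    · intro h v hv
      have := h ⟨v, hv.le⟩ hv
      simpa [extendConfig, hv] using this
    · intro h v hv
      have := h v.1 hv
      simpa [extendConfig, hv] using this
  rw [hpre]
  by_cases hτ : ∀ a u, extendConfig σ u = true → extendConfig σ (a :: u) = false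
  · have h1 : {U : Labels b | ∀ v ∈ words b (N + 1), gen ρ U v = extendConfig σ v} =
        Set.pi (words b (N + 1) : Set (List (Fin b))) (cell ρ (extendConfig σ)) := by
      ext U
      rw [Set.mem_ofPred_eq, gen_eq_on_words_iff ρ _ hτ U]
      simp [Set.mem_pi]
    rw [h1, Measure.infinitePi_pi _ fun _ _ => measurableSet_cell _ _ _]
    have h2 := prod_cell_occDensity hlam hb N hτ
    rw [← ENNReal.ofReal_toReal (a := ∏ v ∈ words b (N + 1), volume (cell ρ (extendConfig σ) v))
      (ENNReal.prod_ne_top fun _ _ => measure_ne_top _ _), ENNReal.toReal_prod]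
    change ENNReal.ofReal (∏ v ∈ words b (N + 1), (volume : Measure unitInterval).real _) = _
    rw [h2, ← hC]
    split_ifs with h
    · rw [Set.inter_eq_right.2 (by simpa using hE.2 h), hardcoreMeasure_singleton,
        hardcoreWeight_truncTree, if_pos hτ, ← ENNReal.ofReal_mul (by positivity), ← hZ]
      congr 1
      field_simp
    · rw [Set.inter_singleton_eq_empty.2 (fun hc => h (hE.1 hc))]
      simp
  -- The chain never occupies both ends of an edge, so a configuration that is not independent is
  -- never generated.
  · have h1 : {U : Labels b | ∀ v ∈ words b (N + 1), gen ρ U v = extendConfig σ v} = ∅ := by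
      rw [Set.eq_empty_iff_forall_notMem]
      intro U hU
      have : extendConfig σ = gen ρ U := by
        rw [← gen_words_occDensity]
        congr 1
        funext v
        have := hU v.1 (by simpa using v.2)
        rw [truncate, this, extendConfig, dif_pos v.2]
      apply hτ
      intro a u hu
      rw [this] at hu ⊢
      change (decide (U (a :: u) < ρ (u.length + 1)) && !gen ρ U u) = false
      simp [hu]
    have h2 : hardcoreMeasure (truncTree b (N + 1)) lam {σ} = 0 := by
      rw [hardcoreMeasure_singleton, hardcoreWeight_truncTree, if_neg hτ]; simp
    rw [h1, measure_empty, measure_mono_null Set.inter_subset_right h2, mul_zero]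

/-- The conditioned hardcore measure is a tree-indexed Markov chain. -/
lemma occupiedBoundaryMeasure_eq {lam : ℝ} (hlam : 0 < lam) (hb : b ≠ 0) (N : ℕ) :
    occupiedBoundaryMeasure b lam (N + 1) =
      ⟨markov b (occDensity b lam (N + 1)), inferInstance⟩ := by
  set ρ := occDensity b lam (N + 1) with hρ
  set H := hardcoreMeasure (truncTree b (N + 1)) lam with hH
  set E := {σ : TruncVertex b (N + 1) → Bool |
    ∀ v : TruncVertex b (N + 1), v.1.length = N + 1 → σ v = true} with hE
  obtain ⟨K, hK⟩ := map_truncate_markov_singleton hlam hb N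
  have hmE : MeasurableSet E := E.toFinite.measurableSet
  have h1 : (markov b ρ).map (truncate (N + 1)) = K • H.restrict E := by
    refine Measure.ext_of_singleton fun σ => ?_
    rw [hK σ, Measure.smul_apply, Measure.restrict_apply (measurableSet_singleton σ),
      Set.inter_comm, smul_eq_mul]
  -- Total masses are compared; the left-hand side of `h1` is a probability measure.
  have h2 : K * H E = 1 := by
    have := congrArg (fun μ => μ Set.univ) h1
    have hp : IsProbabilityMeasure ((markov b ρ).map (truncate (N + 1))) :=
      Measure.isProbabilityMeasure_map (measurable_truncate _).aemeasurable
    simpa using this.symm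
  have h3 : K = (H E)⁻¹ := ENNReal.eq_inv_of_mul_eq_one_left h2
  apply Subtype.ext
  change (H[|E]).map extendConfig = markov b ρ
  rw [ProbabilityTheory.cond, ← h3, ← h1, markov, Measure.map_map (measurable_truncate _) (measurable_gen ρ),
    Measure.map_map (measurable_extendConfig _)
      ((measurable_truncate _).comp (measurable_gen ρ))]
  congr 1
  funext U
  exact gen_words_occDensity lam (N + 1) U

/-! ### The fixed points of the squared recursion -/

/-- The geometric mean lies below the logarithmic mean: this is t < sinh t at t = log(y/x)/2. -/
lemma log_lt_sub_div_sqrt {x y : ℝ} (hx : 0 < x) (hxy : x < y) :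
    Real.log y - Real.log x < (y - x) / √(x * y) := by
  have hy : 0 < y := hx.trans hxy
  set t := (Real.log y - Real.log x) / 2 with ht
  have ht0 : 0 < t := by
    have := Real.log_lt_log hx hxy
    rw [ht]; linarith
  have h1 := Real.self_lt_sinh_iff.2 ht0
  rw [Real.sinh_eq] at h1
  have e1 : Real.exp t = √y / √x := by
    rw [ht, sub_div, Real.exp_sub, ← Real.log_sqrt hy.le, ← Real.log_sqrt hx.le,
      Real.exp_log (Real.sqrt_pos.2 hy), Real.exp_log (Real.sqrt_pos.2 hx)]
  have e2 : Real.exp (-t) = √x / √y := by rw [Real.exp_neg, e1, inv_div]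
  have e3 : √y / √x - √x / √y = (y - x) / √(x * y) := by
    have hsx := Real.sqrt_pos.2 hx
    have hsy := Real.sqrt_pos.2 hy
    rw [Real.sqrt_mul hx.le]
    field_simp
    rw [Real.sq_sqrt hx.le, Real.sq_sqrt hy.le]
  rw [e1, e2, e3] at h1
  linarith

/-- The logarithmic mean lies below the arithmetic mean: keep the first term of the series of
log((1+u)/(1-u)) at u = (y-x)/(y+x). -/
lemma two_mul_div_le_log {x y : ℝ} (hx : 0 < x) (hxy : x < y) :
    2 * (y - x) / (y + x) ≤ Real.log y - Real.log x := by
  have hy : 0 < y := hx.trans hxy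
  set u := (y - x) / (y + x) with hu
  have hu0 : 0 ≤ u := div_nonneg (by linarith) (by linarith)
  have hu1 : u < 1 := by rw [hu, div_lt_one (by linarith)]; linarith
  have hs := Real.hasSum_log_sub_log_of_abs_lt_one (x := u) (by rwa [abs_of_nonneg hu0])
  have h1 := hs.summable.sum_le_tsum {0} (fun i _ => by positivity)
  rw [hs.tsum_eq] at h1
  have e1 : 1 + u = 2 * y / (y + x) := by rw [hu]; field_simp; ring
  have e2 : 1 - u = 2 * x / (y + x) := by rw [hu]; field_simp; ring
  rw [e1, e2, Real.log_div (by positivity) (by positivity),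
    Real.log_div (by positivity) (by positivity), Real.log_mul (by norm_num) hy.ne',
    Real.log_mul (by norm_num) hx.ne'] at h1
  simp at h1
  rw [mul_div_assoc, ← hu]
  linarith

/-- The two-step recursion is a contraction near a nontrivial two-cycle. -/
lemma sq_mul_lt_one {lam p q : ℝ} (hb : 2 ≤ b) (hlam : 0 < lam) (hp : 0 < p) (hpq : p < q)
    (hq : q < 1) (h1 : p = lam * (1 - q) ^ b * (1 - p)) (h2 : q = lam * (1 - p) ^ b * (1 - q)) :
    (b : ℝ) ^ 2 * (p * q) < 1 := by
  have hp' : 0 < 1 - p := by linarith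
  have hq' : 0 < 1 - q := by linarith
  have hq0 : 0 < q := hp.trans hpq
  have l1 := congrArg Real.log h1
  have l2 := congrArg Real.log h2
  rw [Real.log_mul (by positivity) hp'.ne', Real.log_mul hlam.ne' (by positivity),
    Real.log_pow] at l1
  rw [Real.log_mul (by positivity) hq'.ne', Real.log_mul hlam.ne' (by positivity),
    Real.log_pow] at l2
  have k1 := log_lt_sub_div_sqrt hp hpq
  have k2 := two_mul_div_le_log hq' (by linarith : 1 - q < 1 - p)
  set G := √(p * q) with hG
  have hG0 : 0 < G := Real.sqrt_pos.2 (by positivity)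
  have hGA : 2 * G ≤ p + q := by
    have := two_mul_le_add_sq (√p) (√q)
    rw [Real.sq_sqrt hp.le, Real.sq_sqrt hq0.le] at this
    rw [hG, Real.sqrt_mul hp.le]; linarith
  have hb1 : (1 : ℝ) ≤ (b : ℝ) - 1 := by
    have : (2 : ℝ) ≤ b := by exact_mod_cast hb
    linarith
  -- Subtracting the logarithms of the two equations eliminates `lam`.
  have k3 : Real.log q - Real.log p = ((b : ℝ) - 1) * (Real.log (1 - p) - Real.log (1 - q)) := by
    linear_combination l2 - l1
  have k4 : ((b : ℝ) - 1) * (2 * (1 - p - (1 - q)) / (1 - p + (1 - q))) < (q - p) / G := by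
    refine lt_of_le_of_lt ?_ k1
    rw [k3]
    gcongr
  have hS : 0 < 1 - p + (1 - q) := by linarith
  rw [← mul_div_assoc, div_lt_div_iff₀ hS hG0] at k4
  have k5 : ((b : ℝ) - 1) * 2 * G < 1 - p + (1 - q) := by
    have : 0 < q - p := by linarith
    nlinarith
  -- `k5` reads 2(b-1)G < 2 - (p+q); adding 2G ≤ p+q gives 2bG < 2.
  have k6 : (b : ℝ) * G < 1 := by linarith
  have : (b : ℝ) ^ 2 * (p * q) = (b * G) ^ 2 := by
    rw [mul_pow, hG, Real.sq_sqrt (by positivity)]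
  rw [this]
  exact pow_lt_one₀ (by positivity) k6 two_ne_zero

/-! ### Elementary properties of the recursion and the barrier 1/b. -/

lemma hcStep_lt_one {lam x : ℝ} (hlam : 0 < lam) (hx : x ≤ 1) : hcStep b lam x < 1 := by
  have : 0 ≤ lam * (1 - x) ^ b := mul_nonneg hlam.le (pow_nonneg (by linarith) _)
  unfold hcStep; rw [div_lt_one (by linarith)]; linarith

lemma hcStep_pos {lam x : ℝ} (hlam : 0 < lam) (hx : x < 1) : 0 < hcStep b lam x := by
  have : 0 < lam * (1 - x) ^ b := mul_pos hlam (pow_pos (by linarith) _)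
  unfold hcStep; positivity

lemma hcStep_anti {lam x y : ℝ} (hlam : 0 < lam) (hxy : x ≤ y) (hy : y ≤ 1) :
    hcStep b lam y ≤ hcStep b lam x := by
  have h0 : 0 ≤ lam * (1 - y) ^ b := mul_nonneg hlam.le (pow_nonneg (by linarith) _)
  have h1 : lam * (1 - y) ^ b ≤ lam * (1 - x) ^ b := by gcongr
  unfold hcStep
  rw [div_le_div_iff₀ (by linarith) (by linarith)]
  nlinarith

lemma hcStep_eq {lam x : ℝ} (hlam : 0 < lam) (hx : x ≤ 1) :
    hcStep b lam x = lam * (1 - x) ^ b * (1 - hcStep b lam x) := by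
  have : 0 ≤ lam * (1 - x) ^ b := mul_nonneg hlam.le (pow_nonneg (by linarith) _)
  unfold hcStep; field_simp; ring

lemma continuousAt_hcStep {lam x : ℝ} (hlam : 0 < lam) (hx : x ≤ 1) :
    ContinuousAt (hcStep b lam) x := by
  have : 0 ≤ lam * (1 - x) ^ b := mul_nonneg hlam.le (pow_nonneg (by linarith) _)
  unfold hcStep
  exact ContinuousAt.div (by fun_prop) (by fun_prop) (by linarith)

lemma hcStep_le_iff {lam x c : ℝ} (hlam : 0 < lam) (hx : x ≤ 1) :
    hcStep b lam x ≤ c ↔ lam * (1 - x) ^ b * (1 - c) ≤ c := by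
  have : 0 ≤ lam * (1 - x) ^ b := mul_nonneg hlam.le (pow_nonneg (by linarith) _)
  unfold hcStep
  rw [div_le_iff₀ (by linarith)]
  constructor <;> intro h <;> nlinarith

/-- With b = n + 1, the two-step map is increasing and thus preserves the interval below 1/b; this
keeps the odd iterates there. Eliminating `lam` through `he` reduces the claim to the maximality of
y(1-y)^n at y = 1/(n+1). -/
lemma hcStep_inv_le {lam : ℝ} (hlam : 0 < lam) (n : ℕ) (hn : 1 ≤ n) :
    hcStep (n + 1) lam (hcStep (n + 1) lam (1 / (n + 1))) ≤ 1 / (n + 1) := by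
  have hn0 : (0 : ℝ) < n := by exact_mod_cast hn
  have hc : (1 : ℝ) / (n + 1) < 1 := by rw [div_lt_one (by linarith)]; linarith
  set y := hcStep (n + 1) lam (1 / (n + 1)) with hy
  have hy1 : y < 1 := hcStep_lt_one hlam hc.le
  have hy0 : 0 < y := hcStep_pos hlam hc
  have he : y = lam * (1 - 1 / (n + 1)) ^ (n + 1) * (1 - y) := hcStep_eq hlam hc.le
  have e1 : (1 : ℝ) - 1 / (n + 1) = n / (n + 1) := by field_simp; ring
  rw [hcStep_le_iff hlam hy1.le, e1]
  rw [e1] at he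
  -- the function `y (1-y)^n` is maximal at `1/(n+1)`
  set u := (n + 1) * y - 1 with hu
  -- Both factors are bounded by 1 + x ≤ eˣ, with exponents that cancel.
  have g1 : (n + 1) * y ≤ Real.exp u := by have := Real.add_one_le_exp u; linarith
  have g2 : ((n + 1) / n * (1 - y)) ^ n ≤ Real.exp (-u) := by
    have h3 : (n + 1) / n * (1 - y) ≤ Real.exp (-u / n) := by
      have := Real.add_one_le_exp (-u / n)
      have e : (n + 1) / n * (1 - y) = -u / n + 1 := by rw [hu]; field_simp; ring
      rw [e]; exact this
    have h4 : 0 ≤ (n + 1) / n * (1 - y) := by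
      have : 0 < 1 - y := by linarith
      positivity
    calc _ ≤ Real.exp (-u / n) ^ n := pow_le_pow_left₀ h4 h3 n
      _ = Real.exp (-u) := by rw [← Real.exp_nat_mul]; congr 1; field_simp
  have g3 : (n + 1) * y * ((n + 1) / n * (1 - y)) ^ n ≤ 1 := by
    calc _ ≤ Real.exp u * Real.exp (-u) := by
          have : 0 < 1 - y := by linarith
          gcongr
      _ = 1 := by rw [← Real.exp_add]; simp
  rw [mul_pow, div_pow] at g3
  have hpow : (0 : ℝ) < n ^ n := by positivity
  have hpow' : (0 : ℝ) < (n + 1) ^ n := by positivity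
  have g4 : lam * (1 - y) ^ (n + 1) * (n / (n + 1)) =
      1 / (n + 1) * ((n + 1) * y * ((n + 1) ^ n / n ^ n * (1 - y) ^ n)) := by
    generalize 1 - y = z at he ⊢
    rw [he, div_pow]
    field_simp
    ring
  rw [g4]
  have : (0 : ℝ) < 1 / (n + 1) := by positivity
  nlinarith

/-! ### The two-cycle of limiting densities. -/

/-- The other phase. -/
def _root_.Phase.flip : Phase → Phase
  | .plus => .minus
  | .minus => .plus

@[simp] lemma flip_flip (s : Phase) : s.flip.flip = s := by cases s <;> rfl

lemma occ_le_one (lam : ℝ) (n : ℕ) : (occ b lam n : ℝ) ≤ 1 := (occ b lam n).2.2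

/-- The recursion starts at its largest possible value 1 and each step reverses inequalities. -/
lemma occ_two_step {lam : ℝ} (hlam : 0 < lam) (k : ℕ) :
    (occ b lam (2 * k + 2) : ℝ) ≤ occ b lam (2 * k) ∧
      (occ b lam (2 * k + 1) : ℝ) ≤ occ b lam (2 * k + 3) := by
  have step : ∀ m n, (occ b lam m : ℝ) ≤ occ b lam n →
      (occ b lam (n + 1) : ℝ) ≤ occ b lam (m + 1) := fun m n h => by
    rw [coe_occ_succ hlam, coe_occ_succ hlam]
    exact hcStep_anti hlam h (occ_le_one lam n)
  induction k with
  | zero =>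
    have h0 : (occ b lam (0 + 2) : ℝ) ≤ occ b lam 0 := by
      simpa [occ] using occ_le_one (b := b) lam 2
    exact ⟨h0, step _ _ h0⟩
  | succ k ih =>
    have h := step _ _ ih.2
    exact ⟨h, step _ _ h⟩

lemma exists_phases {lam : ℝ} (hlam : 0 < lam) :
    ∃ q : Phase → unitInterval,
      (∀ s, Tendsto (fun k => occ b lam (s.level k)) atTop (𝓝 (q s))) ∧
      (∀ s, (q s : ℝ) = hcStep b lam (q s.flip)) := by
  have hm : Antitone fun k => (occ b lam (2 * k) : ℝ) :=
    antitone_nat_of_succ_le fun k => (occ_two_step hlam k).1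
  have ho : Monotone fun k => (occ b lam (2 * k + 1) : ℝ) :=
    monotone_nat_of_le_succ fun k => (occ_two_step hlam k).2
  have t1 := tendsto_atTop_ciInf hm ⟨0, by rintro _ ⟨k, rfl⟩; exact (occ b lam _).2.1⟩
  have t2 := tendsto_atTop_ciSup ho ⟨1, by rintro _ ⟨k, rfl⟩; exact (occ b lam _).2.2⟩
  set p := ⨅ k, (occ b lam (2 * k) : ℝ)
  set m := ⨆ k, (occ b lam (2 * k + 1) : ℝ)
  have hp : p ∈ Set.Icc (0 : ℝ) 1 := isClosed_Icc.mem_of_tendsto t1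
    (Eventually.of_forall fun k => (occ b lam _).2)
  have hm' : m ∈ Set.Icc (0 : ℝ) 1 := isClosed_Icc.mem_of_tendsto t2
    (Eventually.of_forall fun k => (occ b lam _).2)
  refine ⟨fun s => match s with | .plus => ⟨p, hp⟩ | .minus => ⟨m, hm'⟩, ?_, ?_⟩
  · rintro (_ | _)
    · exact tendsto_subtype_rng.2 t1
    · exact tendsto_subtype_rng.2 t2
  · rintro (_ | _)
    · refine tendsto_nhds_unique ((tendsto_add_atTop_iff_nat 1).2 t1) ?_
      refine (((continuousAt_hcStep hlam hm'.2).tendsto).comp t2).congr fun k => ?_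
      rw [Function.comp_apply, ← coe_occ_succ hlam]; rfl
    · refine tendsto_nhds_unique t2 ?_
      refine (((continuousAt_hcStep hlam hp.2).tendsto).comp t1).congr fun k => ?_
      rw [Function.comp_apply, ← coe_occ_succ hlam]

/-- The densities of the extremal measures. -/
structure IsPhasePair (b : ℕ) (lam : ℝ) (q : Phase → unitInterval) : Prop where
  pos : ∀ s, 0 < (q s : ℝ)
  lt_one : ∀ s, (q s : ℝ) < 1
  fixed : ∀ s, (q s : ℝ) = lam * (1 - q s.flip) ^ b * (1 - q s)
  contract : ∀ s, (b : ℝ) ^ 2 * (q s * q s.flip) < 1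

/-- The odd iterates start at 0 and stay below 1/b, so q⁻ ≤ 1/b. The condition `hcrit` says
precisely that one step maps 1/b above itself, so q⁺ > 1/b. The two-cycle is therefore nontrivial
and `sq_mul_lt_one` applies. -/
lemma isPhasePair {lam : ℝ} (hb : 2 ≤ b) (hlam : 0 < lam)
    (hcrit : (b : ℝ) ^ b / ((b : ℝ) - 1) ^ (b + 1) < lam) {q : Phase → unitInterval}
    (ht : ∀ s, Tendsto (fun k => occ b lam (s.level k)) atTop (𝓝 (q s)))
    (hq : ∀ s, (q s : ℝ) = hcStep b lam (q s.flip)) : IsPhasePair b lam q := by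
  obtain ⟨n, rfl⟩ : ∃ n, b = n + 1 := ⟨b - 1, by omega⟩
  have hn : 1 ≤ n := by omega
  have hn0 : (0 : ℝ) < n := by exact_mod_cast hn
  have hc : (1 : ℝ) / (n + 1) < 1 := by rw [div_lt_one (by linarith)]; linarith
  have hodd : ∀ k, (occ (n + 1) lam (2 * k + 1) : ℝ) ≤ 1 / (n + 1) := by
    intro k
    induction k with
    | zero =>
      rw [coe_occ_succ hlam]
      simp [occ, hcStep]
      positivity
    | succ k ih =>
      have e : 2 * (k + 1) + 1 = 2 * k + 1 + 1 + 1 := by ring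
      rw [e, coe_occ_succ hlam, coe_occ_succ hlam]
      refine le_trans (hcStep_anti hlam (hcStep_anti hlam ih hc.le) ?_) (hcStep_inv_le hlam n hn)
      exact (hcStep_lt_one hlam (occ_le_one _ _)).le
  have hminus : (q .minus : ℝ) ≤ 1 / (n + 1) :=
    le_of_tendsto' (tendsto_subtype_rng.1 (ht .minus)) hodd
  have hplus : 1 / (n + 1) < (q .plus : ℝ) := by
    rw [hq .plus]
    refine lt_of_lt_of_le ?_ (hcStep_anti hlam hminus hc.le)
    rw [← not_le, hcStep_le_iff hlam hc.le, not_le]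
    have e1 : (1 : ℝ) - 1 / (n + 1) = n / (n + 1) := by field_simp; ring
    push_cast at hcrit
    rw [add_sub_cancel_right, div_lt_iff₀ (by positivity)] at hcrit
    have e2 : lam * (1 - 1 / (n + 1)) ^ (n + 1) * (1 - 1 / (n + 1)) =
        lam * n ^ (n + 1 + 1) / (n + 1) ^ (n + 1) * (1 / (n + 1)) := by
      rw [e1, div_pow]; field_simp; ring
    rw [e2]
    refine lt_mul_of_one_lt_left (by positivity) ?_
    rwa [one_lt_div (by positivity)]
  have hlt : ∀ s, (q s : ℝ) < 1 := fun s => by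
    rw [hq s]; exact hcStep_lt_one hlam (q s.flip).2.2
  have hpos : ∀ s, 0 < (q s : ℝ) := fun s => by
    rw [hq s]; exact hcStep_pos hlam (hlt _)
  have hfix : ∀ s, (q s : ℝ) = lam * (1 - q s.flip) ^ (n + 1) * (1 - q s) := fun s => by
    have := hcStep_eq (b := n + 1) hlam (q s.flip).2.2
    rwa [← hq s] at this
  have key := sq_mul_lt_one hb hlam (hpos .minus) (hminus.trans_lt hplus) (hlt .plus)
    (hfix .minus) (hfix .plus)
  refine ⟨hpos, hlt, hfix, ?_⟩
  rintro (_ | _)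
  · rw [mul_comm (q .plus : ℝ)]; exact key
  · exact key

/-! ### The extremal measures -/

/-- The densities on the levels below a root of phase `s`. -/
def phaseSeq (q : Phase → unitInterval) (s : Phase) (j : ℕ) : unitInterval := q (Phase.flip^[j] s)

/-- The extremal measure of phase `s`. -/
noncomputable abbrev phaseLaw (b : ℕ) (q : Phase → unitInterval) (s : Phase) :
    Measure (TreeConfig b) := markov b (phaseSeq q s)

/-- The extremal measure of phase `s`, conditioned on the spin `x` of the root. -/
noncomputable abbrev phaseRooted (b : ℕ) (q : Phase → unitInterval) (s : Phase) (x : Bool) :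
    Measure (TreeConfig b) := rooted b (phaseSeq q s) x

lemma phaseRooted_true_forall_sub (q : Phase → unitInterval) (s : Phase)
    {E : Fin b → Set (TreeConfig b)} (hE : ∀ a, MeasurableSet (E a)) :
    (phaseRooted b q s true).real {σ | ∀ a, sub a σ ∈ E a} =
      ∏ a, (phaseRooted b q s.flip false).real (E a) :=
  rooted_true_forall_sub _ hE

lemma phaseRooted_false_forall_sub (q : Phase → unitInterval) (s : Phase)
    {E : Fin b → Set (TreeConfig b)} (hE : ∀ a, MeasurableSet (E a)) :
    (phaseRooted b q s false).real {σ | ∀ a, sub a σ ∈ E a} =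
      ∏ a, (phaseLaw b q s.flip).real (E a) :=
  rooted_false_forall_sub _ hE

lemma phaseLaw_real_eq (q : Phase → unitInterval) (s : Phase) {E : Set (TreeConfig b)}
    (hE : MeasurableSet E) :
    (phaseLaw b q s).real E =
      (1 - q s) * (phaseRooted b q s false).real E + q s * (phaseRooted b q s true).real E :=
  markov_real_eq _ hE

lemma measurableSet_root (x : Bool) : MeasurableSet {σ : TreeConfig b | σ [] = x} :=
  measurable_pi_apply (X := fun _ => Bool) ([] : List (Fin b)) (measurableSet_singleton x)

lemma phaseRooted_real_root_not (q : Phase → unitInterval) (s : Phase) {x y : Bool} (h : x ≠ y)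
    (E : Set (TreeConfig b)) : (phaseRooted b q s x).real ({σ | σ [] = y} ∩ E) = 0 := by
  rw [← rooted_real_root]
  convert measureReal_empty
  ext σ
  simp only [Set.mem_inter_iff, Set.mem_ofPred_eq, Set.mem_empty_iff_false, iff_false]
  rintro ⟨h1, h2, _⟩
  exact h (h1.symm.trans h2)

lemma phaseLaw_real_root_true (q : Phase → unitInterval) (s : Phase) {E : Set (TreeConfig b)}
    (hE : MeasurableSet E) :
    (phaseLaw b q s).real ({σ | σ [] = true} ∩ E) = q s * (phaseRooted b q s true).real E := by
  rw [phaseLaw_real_eq q s ((measurableSet_root true).inter hE),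
    phaseRooted_real_root_not q s (by simp), rooted_real_root]
  ring

lemma phaseLaw_real_root_false (q : Phase → unitInterval) (s : Phase) {E : Set (TreeConfig b)}
    (hE : MeasurableSet E) :
    (phaseLaw b q s).real ({σ | σ [] = false} ∩ E) =
      (1 - q s) * (phaseRooted b q s false).real E := by
  rw [phaseLaw_real_eq q s ((measurableSet_root false).inter hE),
    phaseRooted_real_root_not q s (x := true) (by simp), rooted_real_root]
  ring

/-- Going down one level lowers the distance to the occupied level by one, which exchanges the two
phases. -/
lemma tendsto_occDensity {lam : ℝ} {q : Phase → unitInterval}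
    (ht : ∀ s, Tendsto (fun k => occ b lam (s.level k)) atTop (𝓝 (q s))) (s : Phase) (j : ℕ) :
    Tendsto (fun k => occDensity b lam (s.level k) j) atTop (𝓝 (phaseSeq q s j)) := by
  induction j generalizing s with
  | zero => simpa [occDensity, phaseSeq] using ht s
  | succ j ih =>
    have e : ∀ n, occDensity b lam (n + 1) (j + 1) = occDensity b lam n j := fun n => by
      simp [occDensity]
    cases s with
    | plus =>
      rw [← tendsto_add_atTop_iff_nat 1]
      exact (ih .minus).congr fun k => (e _).symm
    | minus => exact (ih .plus).congr fun k => (e _).symm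

/-- The extremal measure of phase `s` as a finite measure. -/
noncomputable def phaseMeasure (b : ℕ) (q : Phase → unitInterval) (s : Phase) :
    FiniteMeasure (TreeConfig b) := ⟨phaseLaw b q s, inferInstance⟩

lemma tendsto_occupiedBoundaryMeasure {lam : ℝ} (hlam : 0 < lam) (hb : b ≠ 0)
    {q : Phase → unitInterval}
    (ht : ∀ s, Tendsto (fun k => occ b lam (s.level k)) atTop (𝓝 (q s))) (s : Phase) :
    Tendsto (fun k => occupiedBoundaryMeasure b lam (s.level k)) atTop
      (𝓝 (phaseMeasure b q s)) := by
  -- The shift discards the case of level 0, to which `occupiedBoundaryMeasure_eq` does not apply.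
  rw [← tendsto_add_atTop_iff_nat 1]
  refine FiniteMeasure.tendsto_iff_forall_integral_tendsto.2 ?_
  intro f
  have h := (tendsto_add_atTop_iff_nat 1).2
    (tendsto_integral_markov (b := b) (tendsto_occDensity ht s) f)
  refine h.congr fun k => ?_
  obtain ⟨N, hN⟩ : ∃ N, s.level (k + 1) = N + 1 := by
    cases s
    · exact ⟨2 * k + 1, by simp only [Phase.level]; ring⟩
    · exact ⟨2 * (k + 1), rfl⟩
  rw [hN, occupiedBoundaryMeasure_eq hlam hb]
  rfl

lemma extremalMeasure_eq {d : ℕ} {lam : ℝ} (hlam : 0 < lam) (hd : d - 1 ≠ 0)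
    {q : Phase → unitInterval}
    (ht : ∀ s, Tendsto (fun k => occ (d - 1) lam (s.level k)) atTop (𝓝 (q s))) (s : Phase) :
    extremalMeasure d lam s = phaseMeasure (d - 1) q s :=
  (tendsto_occupiedBoundaryMeasure hlam hd ht s).limUnder_eq

lemma phaseLaw_real_root (q : Phase → unitInterval) (s : Phase) (x : Bool) :
    (phaseLaw b q s).real {σ | σ [] = x} = if x then (q s : ℝ) else 1 - q s := by
  cases x
  · simpa using phaseLaw_real_root_false (b := b) q s .univ
  · simpa using phaseLaw_real_root_true (b := b) q s .univ

/-! ### Events of a level -/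

/-- The configurations which agree with `σ` on level `ℓ`. -/
def levelSet (ℓ : ℕ) (σ : TreeConfig b) : Set (TreeConfig b) := {τ | ∀ v, v.length = ℓ → τ v = σ v}

/-- Events which only depend on level `ℓ`. -/
def IsLevelEvent (ℓ : ℕ) (E : Set (TreeConfig b)) : Prop :=
  ∀ σ τ : TreeConfig b, (∀ v, v.length = ℓ → σ v = τ v) → σ ∈ E → τ ∈ E

/-- The restriction of a configuration to level `ℓ`. -/
def onLevel (ℓ : ℕ) (σ : TreeConfig b) : {v : List (Fin b) // v.length = ℓ} → Bool := fun v => σ v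

lemma measurable_onLevel (ℓ : ℕ) : Measurable (onLevel ℓ : TreeConfig b → _) :=
  measurable_pi_lambda _ fun _ => measurable_pi_apply _

instance finite_level (b ℓ : ℕ) : Finite {v : List (Fin b) // v.length = ℓ} :=
  (List.finite_length_eq (Fin b) ℓ).to_subtype

lemma onLevel_preimage_singleton (ℓ : ℕ) (σ : TreeConfig b) :
    onLevel ℓ ⁻¹' {onLevel ℓ σ} = levelSet ℓ σ := by
  ext τ
  simp [onLevel, levelSet, funext_iff]

lemma IsLevelEvent.preimage_image {ℓ : ℕ} {E : Set (TreeConfig b)} (hE : IsLevelEvent ℓ E) :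
    onLevel ℓ ⁻¹' (onLevel ℓ '' E) = E := by
  refine subset_antisymm ?_ (Set.subset_preimage_image _ _)
  rintro τ ⟨σ, hσ, h⟩
  exact hE σ τ (fun v hv => congrFun h ⟨v, hv⟩) hσ

lemma IsLevelEvent.measurableSet {ℓ : ℕ} {E : Set (TreeConfig b)} (hE : IsLevelEvent ℓ E) :
    MeasurableSet E := by
  rw [← hE.preimage_image]
  exact measurable_onLevel ℓ (Set.toFinite _).measurableSet

lemma isLevelEvent_levelSet (ℓ : ℕ) (σ : TreeConfig b) : IsLevelEvent ℓ (levelSet ℓ σ) :=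
  fun _ _ h h1 v hv => (h v hv).symm.trans (h1 v hv)

/-- A level event is a finite union of atoms, so a bound on the conditional probability of `F` on
each atom adds up. -/
lemma IsLevelEvent.mul_real_le {ℓ : ℕ} {E : Set (TreeConfig b)} (hE : IsLevelEvent ℓ E)
    (μ : Measure (TreeConfig b)) [IsProbabilityMeasure μ] {F : Set (TreeConfig b)} {c : ℝ}
    (h : ∀ σ ∈ E, c * μ.real (levelSet ℓ σ) ≤ μ.real (F ∩ levelSet ℓ σ)) :
    c * μ.real E ≤ μ.real (F ∩ E) := by
  classical
  have := Fintype.ofFinite ({v : List (Fin b) // v.length = ℓ} → Bool)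
  set S : Finset ({v : List (Fin b) // v.length = ℓ} → Bool) :=
    (Set.toFinite (onLevel ℓ '' E)).toFinset
  have hS : onLevel ℓ ⁻¹' (S : Set _) = E := by simpa [S] using hE.preimage_image
  have hm : ∀ y ∈ S, MeasurableSet (onLevel (b := b) ℓ ⁻¹' {y}) := fun y _ =>
    measurable_onLevel ℓ (measurableSet_singleton y)
  have e1 := sum_measureReal_preimage_singleton (μ := μ) S hm
  have e2 := sum_measureReal_preimage_singleton (μ := μ.restrict F) S hm
  rw [hS] at e1 e2
  rw [Set.inter_comm, ← measureReal_restrict_apply hE.measurableSet, ← e1, ← e2, Finset.mul_sum]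
  refine Finset.sum_le_sum fun y hy => ?_
  obtain ⟨σ, hσ, rfl⟩ : y ∈ onLevel ℓ '' E := by simpa [S] using hy
  rw [onLevel_preimage_singleton, measureReal_restrict_apply (isLevelEvent_levelSet ℓ σ).measurableSet,
    Set.inter_comm]
  exact h σ hσ

/-! ### The posterior -/

/-- The posterior of the root given the spins of level `ℓ`. -/
noncomputable def post (lam : ℝ) : ℕ → TreeConfig b → ℝ
  | 0, σ => if σ [] then 1 else 0
  | ℓ + 1, σ => (lam * ∏ a, (1 - post lam ℓ (sub a σ))) /
      (1 + lam * ∏ a, (1 - post lam ℓ (sub a σ)))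

lemma post_mem {lam : ℝ} (hlam : 0 < lam) (ℓ : ℕ) (σ : TreeConfig b) :
    post lam ℓ σ ∈ Set.Icc (0 : ℝ) 1 := by
  induction ℓ generalizing σ with
  | zero => unfold post; split_ifs <;> simp
  | succ ℓ ih =>
    have : 0 ≤ lam * ∏ a, (1 - post lam ℓ (sub a σ)) :=
      mul_nonneg hlam.le (Finset.prod_nonneg fun a _ => sub_nonneg.2 (ih _).2)
    unfold post
    exact ⟨by positivity, by rw [div_le_one (by linarith)]; linarith⟩

lemma one_sub_post_succ {lam : ℝ} (hlam : 0 < lam) (ℓ : ℕ) (σ : TreeConfig b) :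
    1 - post lam (ℓ + 1) σ = 1 / (1 + lam * ∏ a, (1 - post lam ℓ (sub a σ))) := by
  have : 0 ≤ lam * ∏ a, (1 - post lam ℓ (sub a σ)) :=
    mul_nonneg hlam.le (Finset.prod_nonneg fun a _ => sub_nonneg.2 (post_mem hlam _ _).2)
  rw [post]; field_simp; ring

lemma sub_eq_on_level {ℓ : ℕ} {σ τ : TreeConfig b} (h : ∀ v, v.length = ℓ + 1 → σ v = τ v)
    (a : Fin b) (v : List (Fin b)) (hv : v.length = ℓ) : sub a σ v = sub a τ v :=
  h _ (by simp [hv])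

lemma post_congr (lam : ℝ) {ℓ : ℕ} {σ τ : TreeConfig b} (h : ∀ v, v.length = ℓ → σ v = τ v) :
    post lam ℓ σ = post lam ℓ τ := by
  induction ℓ generalizing σ τ with
  | zero => simp [post, h [] rfl]
  | succ ℓ ih => simp only [post, fun a => ih (sub_eq_on_level h a)]

lemma isLevelEvent_post (lam : ℝ) (ℓ : ℕ) (S : Set ℝ) :
    IsLevelEvent ℓ {σ : TreeConfig b | post lam ℓ σ ∈ S} := fun _ _ h hσ => by
  rwa [Set.mem_ofPred_eq, ← post_congr lam h]

lemma levelSet_succ (ℓ : ℕ) (σ : TreeConfig b) :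
    levelSet (ℓ + 1) σ = {τ | ∀ a, sub a τ ∈ levelSet ℓ (sub a σ)} := by
  ext τ
  constructor
  · intro h a v hv
    exact h _ (by simp [hv])
  · intro h v hv
    rcases List.eq_nil_or_concat' v with rfl | ⟨w, a, rfl⟩
    · simp at hv
    · exact h a w (by simpa using hv)

/-- Bayes' rule along the tree. Below an occupied root all children are empty, and `hchild`
expresses their likelihoods by their posteriors; the fixed-point equation then cancels the
densities, so the posterior odds are `lam` times a product and the recursion is the same in both
phases. Positivity is carried along because it makes the conditioning meaningful. -/
lemma phaseLaw_levelSet {lam : ℝ} {q : Phase → unitInterval} (hq : IsPhasePair b lam q) (s : Phase)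
    (ℓ : ℕ) (σ : TreeConfig b) :
    0 < (phaseLaw b q s).real (levelSet ℓ σ) ∧
    q s * (phaseRooted b q s true).real (levelSet ℓ σ) =
      post lam ℓ σ * (phaseLaw b q s).real (levelSet ℓ σ) := by
  have hm : ∀ ℓ (σ : TreeConfig b), MeasurableSet (levelSet ℓ σ) := fun ℓ σ =>
    (isLevelEvent_levelSet ℓ σ).measurableSet
  induction ℓ generalizing s σ with
  | zero =>
    have hl : levelSet 0 σ = {τ | τ [] = σ []} := by
      ext τ; simp [levelSet]
    rw [← phaseLaw_real_root_true q s (hm 0 σ), hl, phaseLaw_real_root, post]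
    have h1 := hq.pos s
    have h2 := hq.lt_one s
    rcases hσ : σ [] with _ | _
    · have : {τ : TreeConfig b | τ [] = true} ∩ {τ | τ [] = false} = ∅ := by
        ext τ; simp +contextual
      rw [this]
      simp [h2]
    · simp [h1, phaseLaw_real_root]
  | succ ℓ ih =>
    have hR1 := phaseRooted_true_forall_sub q s fun a => hm ℓ (sub a σ)
    have hR0 := phaseRooted_false_forall_sub q s fun a => hm ℓ (sub a σ)
    rw [← levelSet_succ] at hR1 hR0
    have hP := phaseLaw_real_eq q s (hm (ℓ + 1) σ)
    have h1 := hq.pos s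
    have h2 := hq.lt_one s
    have hpos0 : 0 < (phaseRooted b q s false).real (levelSet (ℓ + 1) σ) := by
      rw [hR0]; exact Finset.prod_pos fun a _ => (ih s.flip (sub a σ)).1
    have hpos : 0 < (phaseLaw b q s).real (levelSet (ℓ + 1) σ) := by
      rw [hP]
      have : 0 ≤ (phaseRooted b q s true).real (levelSet (ℓ + 1) σ) := measureReal_nonneg
      have := mul_pos (sub_pos.2 h2) hpos0
      positivity
    refine ⟨hpos, ?_⟩
    have hchild : ∀ a, (1 - q s.flip) * (phaseRooted b q s.flip false).real (levelSet ℓ (sub a σ)) =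
        (1 - post lam ℓ (sub a σ)) * (phaseLaw b q s.flip).real (levelSet ℓ (sub a σ)) := fun a => by
      have e1 := (ih s.flip (sub a σ)).2
      have e2 := phaseLaw_real_eq q s.flip (hm ℓ (sub a σ))
      linear_combination -e1 - e2
    have hprod : (1 - q s.flip : ℝ) ^ b * (phaseRooted b q s true).real (levelSet (ℓ + 1) σ) =
        (∏ a, (1 - post lam ℓ (sub a σ))) * (phaseRooted b q s false).real (levelSet (ℓ + 1) σ) := by
      rw [hR1, hR0, ← Finset.prod_mul_distrib, ← Finset.prod_congr rfl fun a _ => hchild a,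
        Finset.prod_mul_distrib]
      simp
    have hkey : q s * (phaseRooted b q s true).real (levelSet (ℓ + 1) σ) =
        (lam * ∏ a, (1 - post lam ℓ (sub a σ))) *
          ((1 - q s) * (phaseRooted b q s false).real (levelSet (ℓ + 1) σ)) := by
      linear_combination (phaseRooted b q s true).real (levelSet (ℓ + 1) σ) * hq.fixed s +
        lam * (1 - q s) * hprod
    -- The sign of `lam` is read off from the fixed-point equation with a positive left-hand side.
    have hlam : 0 < lam := by
      by_contra hc
      have h3 := hq.fixed s
      have h4 : lam * (1 - q s.flip) ^ b * (1 - q s) ≤ 0 := by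
        have : (0 : ℝ) ≤ (1 - q s.flip) ^ b := pow_nonneg (by linarith [hq.lt_one s.flip]) _
        rw [mul_assoc]
        exact mul_nonpos_of_nonpos_of_nonneg (not_lt.1 hc) (mul_nonneg this (by linarith))
      linarith
    have hΛ : 0 ≤ lam * ∏ a, (1 - post lam ℓ (sub a σ)) :=
      mul_nonneg hlam.le (Finset.prod_nonneg fun a _ => sub_nonneg.2 (post_mem hlam _ _).2)
    rw [hP, post]
    field_simp
    linear_combination hkey

lemma posterior_eq_post {d : ℕ} {lam : ℝ} (hlam : 0 < lam) (hd : d - 1 ≠ 0)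
    {q : Phase → unitInterval} (hq : IsPhasePair (d - 1) lam q)
    (ht : ∀ s, Tendsto (fun k => occ (d - 1) lam (s.level k)) atTop (𝓝 (q s))) (s : Phase) (ℓ : ℕ)
    (σ : TreeConfig (d - 1)) : rootPosterior d lam s ℓ σ = post lam ℓ σ := by
  unfold rootPosterior _root_.posterior
  rw [extremalMeasure_eq hlam hd ht]
  have hm := (isLevelEvent_levelSet ℓ σ).measurableSet
  have hset : {τ : TreeConfig (d - 1) | ∀ v : {v : List (Fin (d - 1)) // v.length = ℓ},
      τ v.1 = σ v.1} = levelSet ℓ σ := by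
    ext τ; simp [levelSet]
  rw [hset]
  change ((phaseLaw (d - 1) q s)[|levelSet ℓ σ]).real {τ | τ [] = true} = _
  obtain ⟨h1, h2⟩ := phaseLaw_levelSet hq s ℓ σ
  rw [Measure.real, cond_apply hm, ENNReal.toReal_mul, ENNReal.toReal_inv, Set.inter_comm]
  change ((phaseLaw (d - 1) q s).real _)⁻¹ * (phaseLaw (d - 1) q s).real _ = _
  rw [phaseLaw_real_root_true q s hm, h2]
  field_simp

lemma rootDensity_eq {d : ℕ} {lam : ℝ} (hlam : 0 < lam) (hd : d - 1 ≠ 0)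
    {q : Phase → unitInterval}
    (ht : ∀ s, Tendsto (fun k => occ (d - 1) lam (s.level k)) atTop (𝓝 (q s))) (s : Phase) :
    rootDensity d lam s = q s := by
  unfold rootDensity
  rw [extremalMeasure_eq hlam hd ht]
  exact phaseLaw_real_root q s true

/-! ### The posterior concentrates -/

/-- The bound for the influence of the root on level `ℓ`. -/
noncomputable def influence (b : ℕ) (q : Phase → unitInterval) (s : Phase) (ℓ : ℕ) : ℝ :=
  (b : ℝ) ^ ℓ * ∏ j ∈ Finset.range ℓ, (phaseSeq q s (j + 1) : ℝ)

lemma phaseRooted_real_le (q : Phase → unitInterval) (s : Phase) (ℓ : ℕ) {E : Set (TreeConfig b)}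
    (hE : IsLevelEvent ℓ E) (x y : Bool) :
    (phaseRooted b q s x).real E ≤ (phaseRooted b q s y).real E + influence b q s ℓ :=
  rooted_real_sub_le _ ℓ hE.measurableSet hE x y

/-- Two consecutive levels carry one density of each phase, whichever phase comes first. -/
lemma influence_add_two (q : Phase → unitInterval) (s : Phase) (ℓ : ℕ) :
    influence b q s (ℓ + 2) = (b : ℝ) ^ 2 * (q s * q s.flip) * influence b q s ℓ := by
  have h : (phaseSeq q s (ℓ + 1) : ℝ) * phaseSeq q s (ℓ + 1 + 1) = q s * q s.flip := by
    simp only [phaseSeq, Function.iterate_succ_apply' _ (ℓ + 1)]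
    cases Phase.flip^[ℓ + 1] s <;> cases s <;> simp [Phase.flip, mul_comm]
  unfold influence
  rw [Finset.prod_range_succ, Finset.prod_range_succ, ← h]
  ring

lemma tendsto_influence {lam : ℝ} {q : Phase → unitInterval} (hq : IsPhasePair b lam q) (s : Phase) :
    Tendsto (influence b q s) atTop (𝓝 0) := by
  set c := (b : ℝ) ^ 2 * (q s * q s.flip) with hc
  have hc0 : 0 ≤ c := mul_nonneg (by positivity) (mul_nonneg (q s).2.1 (q s.flip).2.1)
  have h : ∀ i k, influence b q s (2 * k + i) = c ^ k * influence b q s i := by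
    intro i k
    induction k with
    | zero => simp
    | succ k ih =>
      rw [show 2 * (k + 1) + i = 2 * k + i + 2 by ring, influence_add_two, ih, pow_succ]
      ring
  have ht : ∀ i, Tendsto (fun k => influence b q s (2 * k + i)) atTop (𝓝 0) := by
    intro i
    simp only [h]
    simpa using (tendsto_pow_atTop_nhds_zero_of_lt_one hc0 (hq.contract s)).mul_const
      (influence b q s i)
  rw [Metric.tendsto_atTop]
  intro ε hε
  obtain ⟨N0, h0⟩ := Metric.tendsto_atTop.1 (ht 0) ε hε
  obtain ⟨N1, h1⟩ := Metric.tendsto_atTop.1 (ht 1) ε hε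
  refine ⟨2 * (N0 + N1) + 1, fun n hn => ?_⟩
  rcases Nat.even_or_odd' n with ⟨k, rfl | rfl⟩
  · exact h0 k (by omega)
  · exact h1 k (by omega)

/-- Let E be the event. Averaging the posterior over E gives q P₁(E) ≥ (q+ε) P(E), so ε P(E) ≤ q
(P₁(E) - P(E)) = q(1-q)(P₁(E) - P₀(E)), and the last difference is at most the influence of the
root. -/
lemma mul_phaseLaw_post_ge_le {lam : ℝ} {q : Phase → unitInterval}
    (hq : IsPhasePair b lam q) (s : Phase) (ℓ : ℕ) (ε : ℝ) :
    ε * (phaseLaw b q s).real {σ | q s + ε ≤ post lam ℓ σ} ≤ influence b q s ℓ := by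
  set E := {σ : TreeConfig b | q s + ε ≤ post lam ℓ σ}
  have hE : IsLevelEvent ℓ E := isLevelEvent_post lam ℓ (Set.Ici (q s + ε))
  have h1 : (q s + ε) * (phaseLaw b q s).real E ≤ _ :=
    hE.mul_real_le (phaseLaw b q s) (F := {σ | σ [] = true}) fun σ hσ => by
      rw [phaseLaw_real_root_true q s (isLevelEvent_levelSet ℓ σ).measurableSet,
        (phaseLaw_levelSet hq s ℓ σ).2]
      gcongr
      exact hσ
  rw [phaseLaw_real_root_true q s hE.measurableSet] at h1
  have h2 := phaseLaw_real_eq q s hE.measurableSet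
  have h3 := phaseRooted_real_le q s ℓ hE true false
  have h4 := hq.pos s
  have h5 := hq.lt_one s
  have h7 : (0 : ℝ) ≤ influence b q s ℓ :=
    mul_nonneg (by positivity) (Finset.prod_nonneg fun j _ => (phaseSeq q s (j + 1)).2.1)
  nlinarith [mul_le_mul_of_nonneg_left h3 (mul_pos h4 (sub_pos.2 h5)).le,
    mul_nonneg h4.le h7, mul_nonneg (sub_pos.2 h5).le h7,
    mul_nonneg (mul_nonneg h4.le h4.le) h7]

lemma mul_phaseLaw_post_le_le {lam : ℝ} {q : Phase → unitInterval}
    (hq : IsPhasePair b lam q) (s : Phase) (ℓ : ℕ) (ε : ℝ) :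
    ε * (phaseLaw b q s).real {σ | post lam ℓ σ ≤ q s - ε} ≤ influence b q s ℓ := by
  set E := {σ : TreeConfig b | post lam ℓ σ ≤ q s - ε}
  have hE : IsLevelEvent ℓ E := isLevelEvent_post lam ℓ (Set.Iic (q s - ε))
  have h1 : (1 - (q s - ε)) * (phaseLaw b q s).real E ≤ _ :=
    hE.mul_real_le (phaseLaw b q s) (F := {σ | σ [] = false}) fun σ hσ => by
      have hm := (isLevelEvent_levelSet ℓ σ).measurableSet
      have e : (1 - q s) * (phaseRooted b q s false).real (levelSet ℓ σ) =
          (1 - post lam ℓ σ) * (phaseLaw b q s).real (levelSet ℓ σ) := by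
        linear_combination -(phaseLaw_levelSet hq s ℓ σ).2 - phaseLaw_real_eq q s hm
      rw [phaseLaw_real_root_false q s hm, e]
      gcongr
      exact hσ
  rw [phaseLaw_real_root_false q s hE.measurableSet] at h1
  have h2 := phaseLaw_real_eq q s hE.measurableSet
  have h3 := phaseRooted_real_le q s ℓ hE false true
  have h4 := hq.pos s
  have h5 := hq.lt_one s
  have h7 : (0 : ℝ) ≤ influence b q s ℓ :=
    mul_nonneg (by positivity) (Finset.prod_nonneg fun j _ => (phaseSeq q s (j + 1)).2.1)
  nlinarith [mul_le_mul_of_nonneg_left h3 (mul_pos h4 (sub_pos.2 h5)).le,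
    mul_nonneg h4.le h7, mul_nonneg (sub_pos.2 h5).le h7,
    mul_nonneg (mul_nonneg h4.le h4.le) h7]

/-- The posterior converges in probability, also conditionally on the root. -/
lemma exists_forall_phaseRooted_post_le {lam : ℝ} {q : Phase → unitInterval}
    (hq : IsPhasePair b lam q) {ε δ : ℝ} (hε : 0 < ε) (hδ : 0 < δ) :
    ∃ N, ∀ ℓ, N ≤ ℓ → ∀ s x, (phaseRooted b q s x).real {σ | ε ≤ |post lam ℓ σ - q s|} ≤ δ := by
  have key : ∀ s x, ∀ᶠ ℓ in atTop,
      (phaseRooted b q s x).real {σ | ε ≤ |post lam ℓ σ - q s|} ≤ δ := by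
    intro s x
    -- The probability of the root spin `x`: conditioning on it costs at most the factor 1/c.
    set c : ℝ := if x then q s else 1 - q s with hc
    have hc0 : 0 < c := by
      have := hq.pos s
      have := hq.lt_one s
      rw [hc]; split_ifs <;> linarith
    filter_upwards [(tendsto_influence hq s).eventually (gt_mem_nhds
      (show 0 < ε * (c * δ) / 2 by positivity))] with ℓ hℓ
    set E := {σ : TreeConfig b | ε ≤ |post lam ℓ σ - q s|}
    have hE : IsLevelEvent ℓ E := isLevelEvent_post lam ℓ {y | ε ≤ |y - q s|}
    have hsub : E ⊆ {σ | q s + ε ≤ post lam ℓ σ} ∪ {σ | post lam ℓ σ ≤ q s - ε} := by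
      intro σ hσ
      rcases le_abs.1 (show ε ≤ |post lam ℓ σ - q s| from hσ) with h | h
      · left; show q s + ε ≤ post lam ℓ σ; linarith
      · right; show post lam ℓ σ ≤ q s - ε; linarith
    have h1 : (phaseLaw b q s).real E ≤ _ :=
      (measureReal_mono hsub).trans (measureReal_union_le _ _)
    have h2 := mul_phaseLaw_post_ge_le hq s ℓ ε
    have h3 := mul_phaseLaw_post_le_le hq s ℓ ε
    have h4 := phaseLaw_real_eq q s hE.measurableSet
    have h5 : c * (phaseRooted b q s x).real E ≤ (phaseLaw b q s).real E := by
      have h6 : 0 ≤ (1 - q s) * (phaseRooted b q s false).real E :=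
        mul_nonneg (by linarith [hq.lt_one s]) measureReal_nonneg
      have h7 : 0 ≤ q s * (phaseRooted b q s true).real E :=
        mul_nonneg (hq.pos s).le measureReal_nonneg
      rw [h4, hc]
      cases x <;> simp <;> linarith
    have h8 : ε * (c * (phaseRooted b q s x).real E) ≤ ε * (c * δ) := by
      have := mul_le_mul_of_nonneg_left (h5.trans h1) hε.le
      linarith
    exact le_of_mul_le_mul_left (le_of_mul_le_mul_left h8 hε) hc0
  have hall := (((key .plus true).and (key .plus false)).and
    ((key .minus true).and (key .minus false)))
  obtain ⟨N, hN⟩ := eventually_atTop.1 hall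
  refine ⟨N, fun ℓ hℓ s x => ?_⟩
  have := hN ℓ hℓ
  cases s <;> cases x <;> tauto

/-! ### The recursion in logarithmic coordinates -/

/-- The hardcore recursion in the coordinate `-log (1 - x)`. -/
noncomputable def logStep (lam S : ℝ) : ℝ := Real.log (1 + lam * Real.exp (-S))

/-- The absolute value of the derivative of `logStep`. -/
noncomputable def logSlope (lam S : ℝ) : ℝ := lam * Real.exp (-S) / (1 + lam * Real.exp (-S))

lemma logSlope_anti {lam : ℝ} (hlam : 0 < lam) : Antitone (logSlope lam) := by
  intro x y h
  have h1 : Real.exp (-y) ≤ Real.exp (-x) := Real.exp_le_exp.2 (by linarith)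
  have h2 := Real.exp_pos (-y)
  have h3 := Real.exp_pos (-x)
  unfold logSlope
  rw [div_le_div_iff₀ (by positivity) (by positivity)]
  nlinarith [mul_le_mul_of_nonneg_left h1 hlam.le]

lemma logSlope_nonneg {lam : ℝ} (hlam : 0 < lam) (S : ℝ) : 0 ≤ logSlope lam S := by
  unfold logSlope; positivity

lemma logSlope_lt_one {lam : ℝ} (hlam : 0 < lam) (S : ℝ) : logSlope lam S < 1 := by
  unfold logSlope
  rw [div_lt_one (by positivity)]
  linarith

lemma continuous_logSlope {lam : ℝ} (hlam : 0 < lam) : Continuous (logSlope lam) := by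
  unfold logSlope
  exact Continuous.div (by fun_prop) (by fun_prop) fun S => by positivity

/-- Mean value inequality; the slope decreases, so it is largest at the left end `S`. -/
lemma abs_logStep_sub_le {lam : ℝ} (hlam : 0 < lam) {S x y : ℝ} (hx : S ≤ x) (hy : S ≤ y) :
    |logStep lam x - logStep lam y| ≤ logSlope lam S * |x - y| := by
  have hd : ∀ z ∈ Set.Ici S, HasDerivWithinAt (logStep lam) (-logSlope lam z) (Set.Ici S) z := by
    intro z _
    have h1 : HasDerivAt (fun z => 1 + lam * Real.exp (-z)) (lam * (Real.exp (-z) * -1)) z :=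
      (((hasDerivAt_neg z).exp).const_mul lam).const_add 1
    have h2 := h1.log (by positivity)
    have e : -logSlope lam z = lam * (Real.exp (-z) * -1) / (1 + lam * Real.exp (-z)) := by
      unfold logSlope; ring
    rw [e]
    exact h2.hasDerivWithinAt
  have := (convex_Ici S).norm_image_sub_le_of_norm_hasDerivWithin_le (C := logSlope lam S) hd
    (fun z hz => by
      rw [norm_neg, Real.norm_of_nonneg (logSlope_nonneg hlam z)]
      exact logSlope_anti hlam hz) hy hx
  simpa using this

lemma logStep_mem {lam : ℝ} (hlam : 0 < lam) {S : ℝ} (hS : 0 ≤ S) :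
    logStep lam S ∈ Set.Icc 0 (Real.log (1 + lam)) := by
  have h0 := Real.exp_pos (-S)
  have h1 : Real.exp (-S) ≤ 1 := Real.exp_le_one_iff.2 (by linarith)
  have h2 : 0 < lam * Real.exp (-S) := by positivity
  exact ⟨Real.log_nonneg (by linarith), Real.log_le_log (by linarith) (by nlinarith)⟩

/-- The posterior in logarithmic coordinates. -/
noncomputable def lpost (lam : ℝ) (ℓ : ℕ) (σ : TreeConfig b) : ℝ := -Real.log (1 - post lam ℓ σ)

lemma one_sub_post_succ_pos {lam : ℝ} (hlam : 0 < lam) (ℓ : ℕ) (σ : TreeConfig b) :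
    0 < 1 - post lam (ℓ + 1) σ := by
  have : 0 ≤ lam * ∏ a, (1 - post lam ℓ (sub a σ)) :=
    mul_nonneg hlam.le (Finset.prod_nonneg fun a _ => sub_nonneg.2 (post_mem hlam _ _).2)
  rw [one_sub_post_succ hlam]; positivity

lemma lpost_nonneg {lam : ℝ} (hlam : 0 < lam) (ℓ : ℕ) (σ : TreeConfig b) : 0 ≤ lpost lam ℓ σ := by
  have := post_mem hlam ℓ σ
  exact neg_nonneg.2 (Real.log_nonpos (by linarith [this.2]) (by linarith [this.1]))

/-- The children are taken at level at least 1, where the posterior is below 1. At level 0 it can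
equal 1, and `Real.log 0 = 0` would break the identity. -/
lemma lpost_succ_succ {lam : ℝ} (hlam : 0 < lam) (ℓ : ℕ) (σ : TreeConfig b) :
    lpost lam (ℓ + 2) σ = logStep lam (∑ a, lpost lam (ℓ + 1) (sub a σ)) := by
  have h : Real.exp (-∑ a, lpost lam (ℓ + 1) (sub a σ)) = ∏ a, (1 - post lam (ℓ + 1) (sub a σ)) := by
    rw [← Finset.sum_neg_distrib, Real.exp_sum]
    refine Finset.prod_congr rfl fun a _ => ?_
    rw [lpost, neg_neg, Real.exp_log (one_sub_post_succ_pos hlam _ _)]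
  rw [logStep, h, lpost, one_sub_post_succ hlam, one_div, Real.log_inv, neg_neg]

lemma lpost_succ_le {lam : ℝ} (hlam : 0 < lam) (ℓ : ℕ) (σ : TreeConfig b) :
    lpost lam (ℓ + 1) σ ≤ Real.log (1 + lam) := by
  have h0 : 0 ≤ ∏ a, (1 - post lam ℓ (sub a σ)) :=
    Finset.prod_nonneg fun a _ => sub_nonneg.2 (post_mem hlam _ _).2
  have h1 : ∏ a, (1 - post lam ℓ (sub a σ)) ≤ 1 :=
    Finset.prod_le_one (fun a _ => sub_nonneg.2 (post_mem hlam _ _).2)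
      fun a _ => by linarith [(post_mem hlam ℓ (sub a σ)).1]
  rw [lpost, one_sub_post_succ hlam, one_div, Real.log_inv, neg_neg]
  exact Real.log_le_log (by positivity) (by nlinarith)

/-- The density of phase `s` in logarithmic coordinates. -/
noncomputable def ldens (q : Phase → unitInterval) (s : Phase) : ℝ := -Real.log (1 - q s)

section phases

variable {lam : ℝ} {q : Phase → unitInterval}

lemma ldens_nonneg (q : Phase → unitInterval) (s : Phase) : 0 ≤ ldens q s :=
  neg_nonneg.2 (Real.log_nonpos (by linarith [(q s).2.2]) (by linarith [(q s).2.1]))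

lemma exp_neg_ldens (hq : IsPhasePair b lam q) (s : Phase) :
    Real.exp (-(b * ldens q s)) = (1 - q s) ^ b := by
  rw [ldens, ← mul_neg, neg_neg, Real.exp_nat_mul, Real.exp_log (by linarith [hq.lt_one s])]

lemma logStep_ldens (hq : IsPhasePair b lam q) (s : Phase) :
    logStep lam (b * ldens q s.flip) = ldens q s := by
  have h1 := hq.lt_one s
  have h2 : 1 + lam * (1 - q s.flip : ℝ) ^ b = (1 - q s : ℝ)⁻¹ := by
    have h3 : (0 : ℝ) < 1 - q s := by linarith
    field_simp
    linarith [hq.fixed s]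
  rw [logStep, exp_neg_ldens hq, h2, Real.log_inv, ldens]

/-- Thus b² q⁺ q⁻ is the derivative of the two-step recursion at equal children. -/
lemma logSlope_ldens (hq : IsPhasePair b lam q) (s : Phase) :
    logSlope lam (b * ldens q s.flip) = q s := by
  have h1 := hq.lt_one s
  have h3 : (0 : ℝ) < 1 - q s := by linarith
  have h2 : 1 + lam * (1 - q s.flip : ℝ) ^ b = (1 - q s : ℝ)⁻¹ := by
    field_simp
    linarith [hq.fixed s]
  rw [logSlope, exp_neg_ldens hq, h2, div_inv_eq_mul]
  exact (hq.fixed s).symm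

lemma ldens_le (hlam : 0 < lam) (hq : IsPhasePair b lam q) (s : Phase) :
    ldens q s ≤ Real.log (1 + lam) := by
  rw [← logStep_ldens hq s]
  exact (logStep_mem hlam (mul_nonneg (by positivity) (ldens_nonneg q _))).2

/-- The recursion is a contraction near the densities, in suitable weights. -/
structure IsContraction (b : ℕ) (lam : ℝ) (q : Phase → unitInterval) (w : Phase → ℝ) (κ ε : ℝ) :
    Prop where
  w_pos : ∀ s, 0 < w s
  κ_pos : 0 < κ
  κ_lt : κ < 1
  ε_pos : 0 < ε
  step : ∀ s c, 0 ≤ c → c ≤ ε → ∀ u : Fin b → ℝ, (∀ a, |u a - ldens q s.flip| ≤ c * w s.flip) →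
    |logStep lam (∑ a, u a) - ldens q s| ≤ κ * c * w s

lemma abs_sum_sub_le (u : Fin b → ℝ) (t : ℝ) : |∑ a, u a - b * t| ≤ ∑ a, |u a - t| := by
  have : ∑ a, u a - b * t = ∑ a, (u a - t) := by simp
  rw [this]
  exact Finset.abs_sum_le_sum_abs _ _

/-- The weights √q balance the two phases: since b √q' · q = b √(q q') · √q, each single step
contracts by κ₀ = b √(q⁺ q⁻) at the fixed point. Taking κ halfway between κ₀ and 1 leaves room for
continuity of the slope nearby. -/
lemma exists_isContraction (hlam : 0 < lam) (hb : b ≠ 0) (hq : IsPhasePair b lam q) :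
    ∃ w κ ε, IsContraction b lam q w κ ε := by
  set κ₀ : ℝ := b * √(q .plus * q .minus) with hκ₀
  have hb0 : (0 : ℝ) < b := by exact_mod_cast Nat.pos_of_ne_zero hb
  have hκ₀0 : 0 < κ₀ := mul_pos hb0 (Real.sqrt_pos.2 (mul_pos (hq.pos _) (hq.pos _)))
  have hκ₀1 : κ₀ < 1 := by
    have h1 := hq.contract .plus
    have h2 : κ₀ ^ 2 < 1 := by
      rw [hκ₀, mul_pow, Real.sq_sqrt (mul_pos (hq.pos _) (hq.pos _)).le]; exact h1
    nlinarith
  set κ := (1 + κ₀) / 2 with hκ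
  have hw : ∀ s, 0 < √(q s : ℝ) := fun s => Real.sqrt_pos.2 (hq.pos s)
  have hev : ∀ s, ∀ᶠ c in 𝓝 (0 : ℝ),
      b * √(q s.flip) * logSlope lam (b * ldens q s.flip - b * c * √(q s.flip)) < κ * √(q s) := by
    intro s
    have hc : Continuous fun c : ℝ =>
        b * √(q s.flip) * logSlope lam (b * ldens q s.flip - b * c * √(q s.flip)) :=
      continuous_const.mul ((continuous_logSlope hlam).comp (by fun_prop))
    refine (hc.tendsto 0).eventually (gt_mem_nhds ?_)
    simp only [mul_zero, zero_mul, sub_zero, logSlope_ldens hq]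
    have e : b * √(q s.flip) * (q s : ℝ) = κ₀ * √(q s) := by
      have e1 : √(q .plus * q .minus : ℝ) = √(q s.flip) * √(q s) := by
        rw [← Real.sqrt_mul (q s.flip).2.1]
        cases s <;> simp [Phase.flip, mul_comm]
      have e2 := Real.mul_self_sqrt (q s).2.1
      rw [hκ₀, e1]
      linear_combination -(b * √(q s.flip)) * e2
    rw [e]
    exact mul_lt_mul_of_pos_right (by rw [hκ]; linarith) (hw s)
  obtain ⟨ε, hε, hball⟩ := Metric.eventually_nhds_iff.1 ((hev .plus).and (hev .minus))
  refine ⟨fun s => √(q s), κ, ε / 2, hw, by rw [hκ]; linarith, by rw [hκ]; linarith,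
    by linarith, fun s c hc0 hc u hu => ?_⟩
  have hb' := hball (y := c) (by rw [Real.dist_eq, sub_zero, abs_of_nonneg hc0]; linarith)
  have hs : b * √(q s.flip) * logSlope lam (b * ldens q s.flip - b * c * √(q s.flip)) <
      κ * √(q s) := by
    cases s
    · exact hb'.1
    · exact hb'.2
  have hsum : |∑ a, u a - b * ldens q s.flip| ≤ b * c * √(q s.flip) := by
    refine (abs_sum_sub_le u _).trans ((Finset.sum_le_sum fun a _ => hu a).trans ?_)
    simp [mul_assoc]
  have h0 : 0 ≤ b * c * √(q s.flip) := (abs_nonneg _).trans hsum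
  have hL := abs_logStep_sub_le hlam (S := b * ldens q s.flip - b * c * √(q s.flip))
    (x := ∑ a, u a) (y := b * ldens q s.flip) (by linarith [(abs_le.1 hsum).1]) (by linarith)
  rw [logStep_ldens hq] at hL
  refine hL.trans ?_
  have hn := logSlope_nonneg hlam (b * ldens q s.flip - b * c * √(q s.flip))
  calc _ ≤ logSlope lam (b * ldens q s.flip - b * c * √(q s.flip)) * (b * c * √(q s.flip)) := by
        gcongr
    _ = c * (b * √(q s.flip) * logSlope lam (b * ldens q s.flip - b * c * √(q s.flip))) := by ring
    _ ≤ c * (κ * √(q s)) := by gcongr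
    _ = κ * c * √(q s) := by ring

/-- A bound valid far from the densities: arguments are nonnegative, so the slope is at most its
value at 0, which is below 1. -/
lemma abs_lpost_sub_le (hlam : 0 < lam) (hq : IsPhasePair b lam q) (s : Phase) (ℓ : ℕ)
    (σ : TreeConfig b) :
    |lpost lam (ℓ + 2) σ - ldens q s| ≤
      logSlope lam 0 * ∑ a, |lpost lam (ℓ + 1) (sub a σ) - ldens q s.flip| := by
  rw [lpost_succ_succ hlam, ← logStep_ldens hq s]
  refine (abs_logStep_sub_le hlam (S := 0)
    (Finset.sum_nonneg fun a _ => lpost_nonneg hlam _ _)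
    (mul_nonneg (by positivity) (ldens_nonneg q _))).trans ?_
  gcongr
  · exact logSlope_nonneg hlam 0
  · exact abs_sum_sub_le _ _

/-! ### Counting bad vertices -/

open Classical in
/-- The number of vertices of level `k` whose subtree configuration is bad. -/
noncomputable def nbad (B : Phase → Set (TreeConfig b)) : ℕ → Phase → TreeConfig b → ℕ
  | 0, s, σ => if σ ∈ B s then 1 else 0
  | k + 1, s, σ => ∑ a, nbad B k s.flip (sub a σ)

/-- The configurations for which the posterior given level `m + 1` is far from the density. -/
def badSet (b : ℕ) (lam : ℝ) (q : Phase → unitInterval) (w : Phase → ℝ) (ε : ℝ) (m : ℕ)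
    (s : Phase) : Set (TreeConfig b) :=
  {σ | ε * w s < |lpost lam (m + 1) σ - ldens q s|}

variable {w : Phase → ℝ} {κ ε : ℝ}

lemma abs_lpost_sub_le_of_nbad_eq_zero (hlam : 0 < lam)
    (hc : IsContraction b lam q w κ ε) (m k : ℕ) (s : Phase) (σ : TreeConfig b)
    (h : nbad (badSet b lam q w ε m) k s σ = 0) :
    |lpost lam (k + m + 1) σ - ldens q s| ≤ κ ^ k * ε * w s := by
  induction k generalizing s σ with
  | zero =>
    by_contra hn
    have hσ : σ ∈ badSet b lam q w ε m s := by
      show ε * w s < |lpost lam (m + 1) σ - ldens q s|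
      simpa using hn
    rw [nbad, if_pos hσ] at h
    cases h
  | succ k ih =>
    simp only [nbad, Finset.sum_eq_zero_iff, Finset.mem_univ, true_implies] at h
    have e : k + 1 + m + 1 = k + m + 2 := by ring
    rw [e, lpost_succ_succ hlam]
    have hk : κ ^ k ≤ 1 := pow_le_one₀ hc.κ_pos.le hc.κ_lt.le
    have := hc.step s (κ ^ k * ε) (mul_nonneg (pow_nonneg hc.κ_pos.le _) hc.ε_pos.le)
      (mul_le_of_le_one_left hc.ε_pos.le hk) _ fun a => ih s.flip (sub a σ) (h a)
    refine this.trans_eq ?_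
    ring

/-- At each level at most one child has the bad vertex below it. The others deviate by at most K βᵏ
in total, so the errors satisfy e(k+1) ≤ β (e(k) + K βᵏ), which accounts for the factor `k + 1`. -/
lemma abs_lpost_sub_le_of_nbad_le_one (hlam : 0 < lam) (hb : b ≠ 0) (hq : IsPhasePair b lam q)
    (hc : IsContraction b lam q w κ ε) {K β : ℝ} (hK : Real.log (1 + lam) ≤ K)
    (hKw : ∀ s, b * ε * w s ≤ K) (hβκ : κ ≤ β) (hβ : logSlope lam 0 ≤ β)
    (m k : ℕ) (s : Phase) (σ : TreeConfig b) (h : nbad (badSet b lam q w ε m) k s σ ≤ 1) :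
    |lpost lam (k + m + 1) σ - ldens q s| ≤ K * (k + 1) * β ^ k := by
  induction k generalizing s σ with
  | zero =>
    have h1 := lpost_nonneg hlam (m + 1) σ
    have h2 := lpost_succ_le hlam m σ
    have h3 := ldens_nonneg q s
    have h4 := ldens_le hlam hq s
    rw [zero_add, abs_le]
    constructor <;> simp <;> linarith
  | succ k ih =>
    rw [nbad] at h
    obtain ⟨a₀, h0, h1⟩ : ∃ a₀ : Fin b, nbad (badSet b lam q w ε m) k s.flip (sub a₀ σ) ≤ 1 ∧
        ∀ a ≠ a₀, nbad (badSet b lam q w ε m) k s.flip (sub a σ) = 0 := by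
      have hle : ∀ a₀ : Fin b, nbad (badSet b lam q w ε m) k s.flip (sub a₀ σ) ≤ 1 := fun a₀ =>
        (Finset.single_le_sum (f := fun a => nbad (badSet b lam q w ε m) k s.flip (sub a σ))
          (fun a _ => Nat.zero_le _) (Finset.mem_univ a₀)).trans h
      by_cases hz : ∀ a : Fin b, nbad (badSet b lam q w ε m) k s.flip (sub a σ) = 0
      · exact ⟨⟨0, Nat.pos_of_ne_zero hb⟩, hle _, fun a _ => hz a⟩
      · push Not at hz
        obtain ⟨a₀, ha₀⟩ := hz
        refine ⟨a₀, hle a₀, fun a ha => ?_⟩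
        have := Finset.sum_le_sum_of_subset_of_nonneg (Finset.subset_univ ({a, a₀} : Finset (Fin b)))
          (f := fun a => nbad (badSet b lam q w ε m) k s.flip (sub a σ)) fun _ _ _ => Nat.zero_le _
        rw [Finset.sum_pair ha] at this
        omega
    have hβ0 : 0 ≤ β := hc.κ_pos.le.trans hβκ
    have hK0 : 0 ≤ K := (Real.log_nonneg (by linarith)).trans hK
    have e : k + 1 + m + 1 = k + m + 2 := by ring
    rw [e]
    refine (abs_lpost_sub_le hlam hq s (k + m) σ).trans ?_
    have hsum : ∑ a, |lpost lam (k + m + 1) (sub a σ) - ldens q s.flip| ≤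
        K * (k + 1) * β ^ k + K * β ^ k := by
      rw [← Finset.add_sum_erase _ _ (Finset.mem_univ a₀)]
      refine add_le_add (ih s.flip _ h0) ?_
      have h2 : ∀ a ∈ (Finset.univ : Finset (Fin b)).erase a₀,
          |lpost lam (k + m + 1) (sub a σ) - ldens q s.flip| ≤ β ^ k * ε * w s.flip := by
        intro a ha
        refine (abs_lpost_sub_le_of_nbad_eq_zero hlam hc m k s.flip _
          (h1 a (Finset.ne_of_mem_erase ha))).trans ?_
        have := hc.κ_pos.le
        have := hc.ε_pos.le
        have := (hc.w_pos s.flip).le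
        gcongr
      refine (Finset.sum_le_sum h2).trans ?_
      rw [Finset.sum_const, nsmul_eq_mul]
      have hcard : (((Finset.univ : Finset (Fin b)).erase a₀).card : ℝ) ≤ b := by
        exact_mod_cast (Finset.card_le_univ _).trans (by simp)
      have hp : 0 ≤ β ^ k * ε * w s.flip :=
        mul_nonneg (mul_nonneg (pow_nonneg hβ0 _) hc.ε_pos.le) (hc.w_pos _).le
      calc _ ≤ b * (β ^ k * ε * w s.flip) := mul_le_mul_of_nonneg_right hcard hp
        _ = b * ε * w s.flip * β ^ k := by ring
        _ ≤ K * β ^ k := mul_le_mul_of_nonneg_right (hKw _) (pow_nonneg hβ0 _)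
    have hS0 : 0 ≤ ∑ a, |lpost lam (k + m + 1) (sub a σ) - ldens q s.flip| :=
      Finset.sum_nonneg fun _ _ => abs_nonneg _
    calc _ ≤ β * (K * (k + 1) * β ^ k + K * β ^ k) := mul_le_mul hβ hsum hS0 hβ0
      _ = _ := by push_cast; ring

/-- Since K(k+1)βᵏ tends to 0, some fixed `k` makes a single bad descendant harmless, uniformly in
`m`. -/
lemma exists_badSet_subset (hlam : 0 < lam) (hb : b ≠ 0) (hq : IsPhasePair b lam q)
    (hc : IsContraction b lam q w κ ε) :
    ∃ k, 1 ≤ k ∧ ∀ m s, badSet b lam q w ε (k + m) s ⊆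
      {σ | 2 ≤ nbad (badSet b lam q w ε m) k s σ} := by
  set β := max κ (logSlope lam 0)
  have hβ0 : 0 ≤ β := hc.κ_pos.le.trans (le_max_left _ _)
  have hβ1 : β < 1 := max_lt hc.κ_lt (logSlope_lt_one hlam 0)
  set K := max (Real.log (1 + lam)) (max (b * ε * w .plus) (b * ε * w .minus))
  have hKw : ∀ s, b * ε * w s ≤ K := by
    rintro (_ | _)
    · exact (le_max_left _ _).trans (le_max_right _ _)
    · exact (le_max_right _ _).trans (le_max_right _ _)
  have ht : Tendsto (fun k : ℕ => K * (k + 1) * β ^ k) atTop (𝓝 0) := by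
    have h1 := tendsto_self_mul_const_pow_of_lt_one hβ0 hβ1
    have h2 := tendsto_pow_atTop_nhds_zero_of_lt_one hβ0 hβ1
    have := (h1.add h2).const_mul K
    simp only [add_zero, mul_zero] at this
    refine this.congr fun k => ?_
    ring
  have hev := (((ht.eventually (gt_mem_nhds (mul_pos hc.ε_pos (hc.w_pos .plus)))).and
    (ht.eventually (gt_mem_nhds (mul_pos hc.ε_pos (hc.w_pos .minus))))).and
    (eventually_ge_atTop 1)).exists
  obtain ⟨k, ⟨hk1, hk2⟩, hk⟩ := hev
  refine ⟨k, hk, fun m s σ hσ => ?_⟩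
  by_contra hlt
  have hle : nbad (badSet b lam q w ε m) k s σ ≤ 1 := by
    simp only [Set.mem_ofPred_eq, not_le] at hlt; omega
  have h1 := abs_lpost_sub_le_of_nbad_le_one hlam hb hq hc (le_max_left _ _) hKw
    (le_max_left _ _) (le_max_right _ _) m k s σ hle
  have h2 : K * (k + 1) * β ^ k < ε * w s := by cases s; exacts [hk1, hk2]
  exact absurd (show ε * w s < |lpost lam (k + m + 1) σ - ldens q s| from hσ)
    (not_lt.2 (h1.trans h2.le))

end phases

/-! ### Probabilistic bounds for the number of bad vertices -/

section phases

variable {lam : ℝ} {q : Phase → unitInterval}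

lemma phaseLaw_real_le {s : Phase} {E : Set (TreeConfig b)} (hE : MeasurableSet E) {p : ℝ}
    (h : ∀ x, (phaseRooted b q s x).real E ≤ p) : (phaseLaw b q s).real E ≤ p := by
  rw [phaseLaw_real_eq q s hE]
  have h1 := mul_le_mul_of_nonneg_left (h false) (sub_nonneg.2 (q s).2.2)
  have h2 := mul_le_mul_of_nonneg_left (h true) (q s).2.1
  linarith

/-- The subtrees are independent given the root spin; asking for bounds uniform in the child spin
`y` covers both the empty and the random child. -/
lemma phaseRooted_forall_sub_le (s : Phase) (x : Bool) {E : Fin b → Set (TreeConfig b)}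
    (hE : ∀ a, MeasurableSet (E a)) {c : Fin b → ℝ}
    (h : ∀ a y, (phaseRooted b q s.flip y).real (E a) ≤ c a) :
    (phaseRooted b q s x).real {σ | ∀ a, sub a σ ∈ E a} ≤ ∏ a, c a := by
  cases x
  · rw [phaseRooted_false_forall_sub q s hE]
    exact Finset.prod_le_prod (fun a _ => measureReal_nonneg)
      fun a _ => phaseLaw_real_le (hE a) (h a)
  · rw [phaseRooted_true_forall_sub q s hE]
    exact Finset.prod_le_prod (fun a _ => measureReal_nonneg) fun a _ => h a false

lemma phaseRooted_sub_le (s : Phase) (x : Bool) (a : Fin b) {E : Set (TreeConfig b)}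
    (hE : MeasurableSet E) {p : ℝ} (h : ∀ y, (phaseRooted b q s.flip y).real E ≤ p) :
    (phaseRooted b q s x).real {σ | sub a σ ∈ E} ≤ p := by
  have := phaseRooted_forall_sub_le (b := b) (q := q) s x
    (E := fun i => if i = a then E else Set.univ) (c := fun i => if i = a then p else 1)
    (fun i => by split_ifs <;> simp [hE]) (fun i y => by split_ifs <;> simp [h])
  rw [Finset.prod_ite_eq' Finset.univ a fun _ => p, if_pos (Finset.mem_univ a)] at this
  refine (measureReal_mono fun σ hσ i => ?_).trans this
  split_ifs with hi
  · subst hi; exact hσ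
  · trivial

lemma phaseRooted_sub_and_le (s : Phase) (x : Bool) {a a' : Fin b} (ha : a ≠ a')
    {E : Set (TreeConfig b)} (hE : MeasurableSet E) {p : ℝ}
    (h : ∀ y, (phaseRooted b q s.flip y).real E ≤ p) :
    (phaseRooted b q s x).real {σ | sub a σ ∈ E ∧ sub a' σ ∈ E} ≤ p ^ 2 := by
  have := phaseRooted_forall_sub_le (b := b) (q := q) s x
    (E := fun i => if i = a then E else if i = a' then E else Set.univ)
    (c := fun i => (if i = a then p else 1) * (if i = a' then p else 1))
    (fun i => by split_ifs <;> simp [hE])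
    (fun i y => by
      by_cases h1 : i = a
      · subst h1; simp [ha, h]
      · by_cases h2 : i = a' <;> simp [h1, h2, h, Ne.symm ha])
  rw [Finset.prod_mul_distrib, Finset.prod_ite_eq' Finset.univ a fun _ => p,
    Finset.prod_ite_eq' Finset.univ a' fun _ => p, if_pos (Finset.mem_univ _),
    if_pos (Finset.mem_univ _), ← sq] at this
  refine (measureReal_mono fun σ hσ i => ?_).trans this
  split_ifs with hi hi'
  · subst hi; exact hσ.1
  · subst hi'; exact hσ.2
  · trivial

variable {B : Phase → Set (TreeConfig b)}

lemma measurable_nbad (hB : ∀ s, MeasurableSet (B s)) (k : ℕ) (s : Phase) :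
    Measurable (nbad B k s) := by
  classical
  induction k generalizing s with
  | zero => exact Measurable.ite (hB s) measurable_const measurable_const
  | succ k ih =>
    exact Finset.measurable_sum _ fun a _ => (ih s.flip).comp (measurable_sub a)

lemma measurableSet_le_nbad (hB : ∀ s, MeasurableSet (B s)) (i k : ℕ) (s : Phase) :
    MeasurableSet {σ | i ≤ nbad B k s σ} :=
  measurable_nbad hB k s (measurableSet_Ici (a := i))

lemma phaseRooted_one_le_nbad (hB : ∀ s, MeasurableSet (B s)) {p : ℝ}
    (h : ∀ s x, (phaseRooted b q s x).real (B s) ≤ p) (k : ℕ) (s : Phase) (x : Bool) :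
    (phaseRooted b q s x).real {σ | 1 ≤ nbad B k s σ} ≤ (b : ℝ) ^ k * p := by
  induction k generalizing s x with
  | zero =>
    have : {σ | 1 ≤ nbad B 0 s σ} = B s := by
      ext σ
      by_cases hσ : σ ∈ B s <;> simp [nbad, hσ]
    rw [this]; simpa using h s x
  | succ k ih =>
    have hsub : {σ | 1 ≤ nbad B (k + 1) s σ} ⊆
        ⋃ a ∈ (Finset.univ : Finset (Fin b)), {σ | sub a σ ∈ {τ | 1 ≤ nbad B k s.flip τ}} := by
      intro σ hσ
      by_contra hc
      simp only [Set.mem_iUnion, Finset.mem_univ, exists_prop, true_and, Set.mem_ofPred_eq,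
        not_exists, not_le, Nat.lt_one_iff] at hc
      have : nbad B (k + 1) s σ = 0 := Finset.sum_eq_zero fun a _ => hc a
      have h1 : 1 ≤ nbad B (k + 1) s σ := hσ
      omega
    refine (measureReal_mono hsub (measure_ne_top _ _)).trans ((measureReal_biUnion_finset_le _ _).trans ?_)
    refine (Finset.sum_le_sum fun a _ => phaseRooted_sub_le s x a
      (measurableSet_le_nbad hB 1 k s.flip) fun y => ih s.flip y).trans_eq ?_
    simp [pow_succ]; ring

/-- The constants in the bound for two bad vertices. -/
noncomputable def pairConst (b : ℕ) : ℕ → ℝ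
  | 0 => 0
  | k + 1 => b * pairConst b k + (b : ℝ) ^ 2 * ((b : ℝ) ^ k) ^ 2

/-- Either two bad vertices lie below the same child, which is the induction hypothesis, or below
different children, where independence gives the square of the bound for one. -/
lemma phaseRooted_two_le_nbad (hB : ∀ s, MeasurableSet (B s)) {p : ℝ}
    (h : ∀ s x, (phaseRooted b q s x).real (B s) ≤ p) (k : ℕ) (s : Phase) (x : Bool) :
    (phaseRooted b q s x).real {σ | 2 ≤ nbad B k s σ} ≤ pairConst b k * p ^ 2 := by
  induction k generalizing s x with
  | zero =>
    have : {σ | 2 ≤ nbad B 0 s σ} = ∅ := by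
      ext σ
      by_cases hσ : σ ∈ B s <;> simp [nbad, hσ]
    rw [this]; simp [pairConst]
  | succ k ih =>
    have hsub : {σ | 2 ≤ nbad B (k + 1) s σ} ⊆
        (⋃ a ∈ (Finset.univ : Finset (Fin b)), {σ | sub a σ ∈ {τ | 2 ≤ nbad B k s.flip τ}}) ∪
        ⋃ e ∈ (Finset.univ : Finset (Fin b)).offDiag, {σ | sub e.1 σ ∈ {τ | 1 ≤ nbad B k s.flip τ} ∧
          sub e.2 σ ∈ {τ | 1 ≤ nbad B k s.flip τ}} := by
      intro σ hσ
      by_contra hc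
      simp only [Set.mem_union, Set.mem_iUnion, Finset.mem_univ, exists_prop, true_and,
        Set.mem_ofPred_eq, not_or, not_exists, not_le, Finset.mem_offDiag, not_and] at hc
      obtain ⟨h1, h2⟩ := hc
      have hle : nbad B (k + 1) s σ ≤ 1 := by
        rw [nbad]
        by_cases hz : ∀ a : Fin b, nbad B k s.flip (sub a σ) = 0
        · simp [hz]
        · push Not at hz
          obtain ⟨a₀, ha₀⟩ := hz
          rw [Finset.sum_eq_single a₀]
          · have := h1 a₀; omega
          · intro a _ ha
            have : nbad B k s.flip (sub a σ) < 1 := h2 (a₀, a) (Ne.symm ha) (Nat.one_le_iff_ne_zero.2 ha₀)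
            omega
          · simp
      have h3 : 2 ≤ nbad B (k + 1) s σ := hσ
      omega
    refine (measureReal_mono hsub (measure_ne_top _ _)).trans ((measureReal_union_le _ _).trans ?_)
    rw [pairConst, add_mul]
    refine add_le_add ?_ ?_
    · refine (measureReal_biUnion_finset_le _ _).trans ?_
      refine (Finset.sum_le_sum fun a _ => phaseRooted_sub_le s x a
        (measurableSet_le_nbad hB 2 k s.flip) fun y => ih s.flip y).trans_eq ?_
      simp [mul_assoc]
    · refine (measureReal_biUnion_finset_le _ _).trans ?_
      refine (Finset.sum_le_sum fun e he => phaseRooted_sub_and_le s x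
        (Finset.mem_offDiag.1 he).2.2 (measurableSet_le_nbad hB 1 k s.flip)
        fun y => phaseRooted_one_le_nbad hB h k s.flip y).trans ?_
      rw [Finset.sum_const, nsmul_eq_mul, mul_pow, mul_assoc]
      refine mul_le_mul_of_nonneg_right ?_ (by positivity)
      rw [Finset.offDiag_card, Finset.card_univ, Fintype.card_fin]
      have : b * b - b ≤ b ^ 2 := by rw [sq]; exact Nat.sub_le _ _
      exact_mod_cast this

variable {w : Phase → ℝ} {κ ε : ℝ}

lemma measurableSet_badSet (m : ℕ) (s : Phase) : MeasurableSet (badSet b lam q w ε m s) :=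
  (isLevelEvent_post (b := b) lam (m + 1)
    {y | ε * w s < |-Real.log (1 - y) - ldens q s|}).measurableSet

/-- Convergence in probability passes to the logarithmic coordinate by continuity at the density;
this starts the bootstrap. -/
lemma exists_forall_badSet_le (hq : IsPhasePair b lam q) (hc : IsContraction b lam q w κ ε) {δ : ℝ}
    (hδ : 0 < δ) :
    ∃ N, ∀ m, N ≤ m → ∀ s x, (phaseRooted b q s x).real (badSet b lam q w ε m s) ≤ δ := by
  have hcont : ∀ s, ∀ᶠ y in 𝓝 (q s : ℝ), |-Real.log (1 - y) - ldens q s| < ε * w s := by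
    intro s
    have h0 : (1 : ℝ) - q s ≠ 0 := by linarith [hq.lt_one s]
    have h1 : ContinuousAt (fun y : ℝ => |-Real.log (1 - y) - ldens q s|) (q s) := by
      have : ContinuousAt (fun y : ℝ => Real.log (1 - y)) (q s) :=
        ContinuousAt.log (by fun_prop) h0
      exact (this.neg.sub continuousAt_const).abs
    refine h1.tendsto.eventually (gt_mem_nhds ?_)
    simpa [ldens] using mul_pos hc.ε_pos (hc.w_pos s)
  obtain ⟨η₁, h1, hη₁⟩ := Metric.eventually_nhds_iff.1 (hcont .plus)
  obtain ⟨η₂, h2, hη₂⟩ := Metric.eventually_nhds_iff.1 (hcont .minus)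
  obtain ⟨N, hN⟩ := exists_forall_phaseRooted_post_le hq (lt_min h1 h2) hδ
  refine ⟨N, fun m hm s x => (measureReal_mono fun σ hσ => ?_).trans (hN (m + 1) (by omega) s x)⟩
  have hσ' : ε * w s < |-Real.log (1 - post lam (m + 1) σ) - ldens q s| := hσ
  by_contra hlt
  simp only [Set.mem_ofPred_eq, not_le] at hlt
  have : |-Real.log (1 - post lam (m + 1) σ) - ldens q s| < ε * w s := by
    cases s
    · exact hη₁ (hlt.trans_le (min_le_left _ _))
    · exact hη₂ (hlt.trans_le (min_le_right _ _))
  linarith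

/-- Bad configurations have doubly exponentially small probability. -/
lemma exists_badSet_le_exp (hlam : 0 < lam) (hb : b ≠ 0) (hq : IsPhasePair b lam q)
    (hc : IsContraction b lam q w κ ε) :
    ∃ k N, 1 ≤ k ∧ ∀ j s x, (phaseRooted b q s x).real (badSet b lam q w ε (k * j + N) s) ≤
      Real.exp (-2 ^ j) := by
  obtain ⟨k, hk, hsub⟩ := exists_badSet_subset hlam hb hq hc
  -- From p' ≤ D p² the quantity D p is squared at each round, so the initial bound exp(-1)/D
  -- becomes exp(-2^j)/D.
  set D := max 1 (pairConst b k) with hD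
  have hD1 : 1 ≤ D := le_max_left _ _
  obtain ⟨N, hN⟩ := exists_forall_badSet_le hq hc (δ := Real.exp (-1) / D) (by positivity)
  refine ⟨k, N, hk, fun j => ?_⟩
  have key : ∀ s x, (phaseRooted b q s x).real (badSet b lam q w ε (k * j + N) s) ≤
      Real.exp (-2 ^ j) / D := by
    induction j with
    | zero => simpa using hN N le_rfl
    | succ j ih =>
      intro s x
      have e : k * (j + 1) + N = k + (k * j + N) := by ring
      rw [e]
      refine (measureReal_mono (hsub _ s)).trans ((phaseRooted_two_le_nbad
        (fun s => measurableSet_badSet _ s) ih k s x).trans ?_)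
      calc pairConst b k * (Real.exp (-2 ^ j) / D) ^ 2
          ≤ D * (Real.exp (-2 ^ j) / D) ^ 2 :=
            mul_le_mul_of_nonneg_right (le_max_right _ _) (by positivity)
        _ = Real.exp (-2 ^ (j + 1)) / D := by
            rw [div_pow, ← Real.exp_nat_mul, pow_succ (2 : ℝ) j]
            field_simp
            congr 1
            push_cast
            ring
  exact fun s x => (key s x).trans (div_le_self (Real.exp_pos _).le hD1)

/-! ### Return to the original coordinate and choice of the rates. -/

lemma abs_sub_le_abs_log_sub {u v : ℝ} (hu : 0 < u) (hu1 : u ≤ 1) (hv : 0 < v) (hv1 : v ≤ 1) :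
    |u - v| ≤ |Real.log u - Real.log v| := by
  wlog h : v ≤ u generalizing u v
  · rw [abs_sub_comm u, abs_sub_comm (Real.log u)]
    exact this hv hv1 hu hu1 (not_le.1 h).le
  have h1 := Real.log_le_log hv h
  rw [abs_of_nonneg (by linarith), abs_of_nonneg (by linarith)]
  have h2 := Real.one_sub_inv_le_log_of_pos (div_pos hu hv)
  rw [Real.log_div hu.ne' hv.ne', inv_div] at h2
  have h3 : u - v ≤ 1 - v / u := by
    have e : 1 - v / u = (u - v) / u := by field_simp
    rw [e, le_div_iff₀ hu]
    nlinarith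
  linarith

lemma abs_post_sub_le (hlam : 0 < lam) (hq : IsPhasePair b lam q) (ℓ : ℕ) (s : Phase)
    (σ : TreeConfig b) : |post lam (ℓ + 1) σ - q s| ≤ |lpost lam (ℓ + 1) σ - ldens q s| := by
  have h := abs_sub_le_abs_log_sub (one_sub_post_succ_pos hlam ℓ σ)
    (by linarith [(post_mem hlam (ℓ + 1) σ).1]) (v := 1 - q s) (by linarith [hq.lt_one s])
    (by linarith [hq.pos s])
  rw [abs_sub_comm] at h
  rw [abs_sub_comm (lpost lam _ _)]
  convert h using 2
  · ring
  · rw [lpost, ldens]; ring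

lemma phaseLaw_post_ge_le (hlam : 0 < lam) (hq : IsPhasePair b lam q)
    (hc : IsContraction b lam q w κ ε) {m n : ℕ} {p r : ℝ}
    (hp : ∀ s x, (phaseRooted b q s x).real (badSet b lam q w ε m s) ≤ p) (s : Phase)
    (hr : κ ^ n * ε * w s < r) :
    (phaseLaw b q s).real {σ | r ≤ |post lam (n + m + 1) σ - q s|} ≤ (b : ℝ) ^ n * p := by
  have hB := fun s => measurableSet_badSet (b := b) (lam := lam) (q := q) (w := w) (ε := ε) m s
  refine (measureReal_mono fun σ hσ => ?_).trans (phaseLaw_real_le (measurableSet_le_nbad hB 1 n s)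
    fun x => phaseRooted_one_le_nbad hB hp n s x)
  by_contra h
  simp only [Set.mem_ofPred_eq, not_le, Nat.lt_one_iff] at h
  have h1 := abs_lpost_sub_le_of_nbad_eq_zero hlam hc m n s σ h
  have h2 := abs_post_sub_le hlam hq (n + m) s σ
  have h3 : r ≤ |post lam (n + m + 1) σ - q s| := hσ
  linarith

end phases

/-- Split ℓ = n + (k j + N) + 1 with k j ≤ ℓ/2. The lower levels make bad vertices doubly
exponentially rare, and the upper n ≥ ℓ/4 levels contract by κⁿ unless some vertex of level n is
bad. The union bound over these costs bⁿ, which is negligible against exp(-2^j). -/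
lemma exists_rates {lam : ℝ} {q : Phase → unitInterval} (hlam : 0 < lam) (hb : b ≠ 0)
    (hq : IsPhasePair b lam q) :
    ∃ ζ₁ : ℝ, 0 < ζ₁ ∧ ∃ ζ₂ : ℝ, 0 < ζ₂ ∧ ∀ s : Phase, ∀ᶠ ℓ : ℕ in atTop,
      (phaseLaw b q s).real {σ | Real.exp (-ζ₁ * ℓ) ≤ |post lam ℓ σ - q s|} ≤
        Real.exp (-Real.exp (ζ₂ * ℓ)) := by
  obtain ⟨w, κ, ε, hc⟩ := exists_isContraction hlam hb hq
  obtain ⟨k, N, hk, hbad⟩ := exists_badSet_le_exp hlam hb hq hc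
  have hk0 : (0 : ℝ) < k := by exact_mod_cast hk
  have hb1 : (1 : ℝ) ≤ b := by exact_mod_cast Nat.one_le_iff_ne_zero.2 hb
  set L := -Real.log κ with hL
  have hL0 : 0 < L := neg_pos.2 (Real.log_neg hc.κ_pos hc.κ_lt)
  set c := Real.log 2 / (2 * k) with hcdef
  have hc0 : 0 < c := div_pos (Real.log_pos (by norm_num)) (by positivity)
  -- Since n ≥ ℓ/4, κⁿ ≤ e^(-Lℓ/4), and half of this exponent absorbs the factor ε w. Likewise 2^j ≥
  -- e^(cℓ)/2, and halving the exponent c leaves room for bⁿ.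
  refine ⟨L / 8, by positivity, c / 2, by positivity, fun s => ?_⟩
  have hcast : Tendsto (fun ℓ : ℕ => (ℓ : ℝ)) atTop atTop := tendsto_natCast_atTop_atTop
  filter_upwards [eventually_ge_atTop (4 * (N + 1)), hcast.eventually_ge_atTop (8 * (ε * w s) / L),
    hcast.eventually_ge_atTop (8 / c), hcast.eventually_ge_atTop (8 * Real.log b / c ^ 2)]
    with ℓ h1 h2 h3 h4
  set j := ℓ / (2 * k) with hj
  have hj1 : 2 * (k * j) ≤ ℓ := by
    have := Nat.mul_div_le ℓ (2 * k)
    rw [← hj] at this; linarith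
  have hj2 : (ℓ : ℝ) / (2 * k) - 1 ≤ j := by
    have := Nat.lt_mul_div_succ ℓ (show 0 < 2 * k by omega)
    rw [← hj] at this
    have h' : (ℓ : ℝ) < 2 * k * (j + 1) := by exact_mod_cast this
    rw [sub_le_iff_le_add, div_le_iff₀ (by positivity)]
    linarith
  obtain ⟨n, hn⟩ : ∃ n, n + (k * j + N) + 1 = ℓ := ⟨ℓ - 1 - (k * j + N), by omega⟩
  have hn4 : (ℓ : ℝ) / 4 ≤ n := by
    have : ℓ ≤ 4 * n := by omega
    have : (ℓ : ℝ) ≤ 4 * n := by exact_mod_cast this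
    linarith
  have hr : κ ^ n * ε * w s < Real.exp (-(L / 8) * ℓ) := by
    have e1 : κ ^ n ≤ Real.exp (-(L / 8) * ℓ) * Real.exp (-(L / 8) * ℓ) := by
      rw [← Real.exp_add, ← Real.exp_log hc.κ_pos, ← Real.exp_nat_mul]
      apply Real.exp_le_exp.2
      have : Real.log κ = -L := by rw [hL, neg_neg]
      rw [this]
      nlinarith
    have e2 : ε * w s < Real.exp (L / 8 * ℓ) := by
      have := Real.add_one_le_exp (L / 8 * ℓ)
      rw [div_le_iff₀ hL0] at h2
      linarith
    have e3 : Real.exp (-(L / 8) * ℓ) * Real.exp (L / 8 * ℓ) = 1 := by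
      rw [← Real.exp_add]; simp
    have hE := Real.exp_pos (-(L / 8) * ℓ)
    have hw0 : 0 < ε * w s := mul_pos hc.ε_pos (hc.w_pos s)
    calc κ ^ n * ε * w s = κ ^ n * (ε * w s) := by ring
      _ ≤ Real.exp (-(L / 8) * ℓ) * Real.exp (-(L / 8) * ℓ) * (ε * w s) := by gcongr
      _ < Real.exp (-(L / 8) * ℓ) * Real.exp (-(L / 8) * ℓ) * Real.exp (L / 8 * ℓ) := by gcongr
      _ = Real.exp (-(L / 8) * ℓ) := by rw [mul_assoc, e3, mul_one]
  have hmain := phaseLaw_post_ge_le hlam hq hc (hbad j) s hr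
  rw [hn] at hmain
  refine hmain.trans ?_
  have hbn : (b : ℝ) ^ n ≤ Real.exp (ℓ * Real.log b) := by
    rw [Real.exp_nat_mul, Real.exp_log (by linarith)]
    exact pow_le_pow_right₀ hb1 (by omega)
  set y := Real.exp (c / 2 * ℓ) with hy
  have hy2 : y ^ 2 / 2 ≤ 2 ^ j := by
    have e1 : y ^ 2 / 2 = Real.exp ((ℓ / (2 * k) - 1) * Real.log 2) := by
      rw [sub_mul, one_mul, Real.exp_sub, Real.exp_log (by norm_num), hy, ← Real.exp_nat_mul]
      congr 2
      rw [hcdef]; field_simp; norm_num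
    have e2 : (2 : ℝ) ^ j = Real.exp (j * Real.log 2) := by
      rw [Real.exp_nat_mul, Real.exp_log (by norm_num)]
    rw [e1, e2]
    exact Real.exp_le_exp.2 (mul_le_mul_of_nonneg_right hj2 (Real.log_nonneg (by norm_num)))
  have hy4 : 4 ≤ y := by
    have := Real.add_one_le_exp (c / 2 * ℓ)
    rw [div_le_iff₀ hc0] at h3
    linarith
  have hyl : ℓ * Real.log b ≤ y ^ 2 / 4 := by
    have e1 : y ^ 2 = Real.exp (c * ℓ) := by
      rw [hy, ← Real.exp_nat_mul]; congr 1; push_cast; ring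
    have e2 := Real.quadratic_le_exp_of_nonneg (show 0 ≤ c * ℓ by positivity)
    have e3 : 0 ≤ c * ℓ := by positivity
    rw [div_le_iff₀ (by positivity)] at h4
    have e4 : (8 * Real.log b) * ℓ ≤ (ℓ * c ^ 2) * ℓ :=
      mul_le_mul_of_nonneg_right h4 (Nat.cast_nonneg ℓ)
    rw [e1]
    nlinarith
  calc (b : ℝ) ^ n * Real.exp (-2 ^ j) ≤ Real.exp (ℓ * Real.log b) * Real.exp (-2 ^ j) := by gcongr
    _ = Real.exp (ℓ * Real.log b + -2 ^ j) := by rw [← Real.exp_add]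
    -- Of the y²/2 ≤ 2^j, one half absorbs ℓ log b and the other is at least y, because y ≥ 4.
    _ ≤ Real.exp (-y) := Real.exp_le_exp.2 (by nlinarith)

end HardcoreTree

theorem mainTheorem5 (d : ℕ) (hd : 3 ≤ d) (lam : ℝ) (hlam : criticalFugacity d < lam) :
    (∀ s : Phase, Tendsto (fun k : ℕ => occupiedBoundaryMeasure (d - 1) lam (s.level k)) atTop
      (𝓝 (extremalMeasure d lam s))) ∧
    (rootDensity d lam .plus ≤ 3 / 5 →
      rootDensity d lam .plus * rootDensity d lam .minus < 1 / ((d : ℝ) - 1) →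
      ∃ ζ₁ : ℝ, 0 < ζ₁ ∧ ∃ ζ₂ : ℝ, 0 < ζ₂ ∧ ∀ s : Phase, ∀ᶠ ℓ : ℕ in atTop,
        (extremalMeasure d lam s : Measure (TreeConfig (d - 1))).real
            {σ | Real.exp (-ζ₁ * ℓ) ≤ |rootPosterior d lam s ℓ σ - rootDensity d lam s|} ≤
          Real.exp (-Real.exp (ζ₂ * ℓ))) := by
  have hb : 2 ≤ d - 1 := by omega
  have hb0 : d - 1 ≠ 0 := by omega
  have hcast : ((d - 1 : ℕ) : ℝ) = d - 1 := by rw [Nat.cast_sub (by omega), Nat.cast_one]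
  have hcrit : ((d - 1 : ℕ) : ℝ) ^ (d - 1) / (((d - 1 : ℕ) : ℝ) - 1) ^ (d - 1 + 1) < lam := by
    rw [hcast, show (d : ℝ) - 1 - 1 = d - 2 by ring, Nat.sub_add_cancel (by omega)]
    exact hlam
  have hlam0 : 0 < lam := by
    refine lt_of_le_of_lt ?_ hlam
    have : (3 : ℝ) ≤ d := by exact_mod_cast hd
    unfold criticalFugacity
    exact div_nonneg (pow_nonneg (by linarith) _) (pow_nonneg (by linarith) _)
  obtain ⟨q, ht, hfix⟩ := HardcoreTree.exists_phases (b := d - 1) hlam0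
  have hq := HardcoreTree.isPhasePair hb hlam0 hcrit ht hfix
  refine ⟨fun s => ?_, fun _ _ => ?_⟩
  · rw [HardcoreTree.extremalMeasure_eq hlam0 hb0 ht]
    exact HardcoreTree.tendsto_occupiedBoundaryMeasure hlam0 hb0 ht s
  · obtain ⟨ζ₁, h₁, ζ₂, h₂, h⟩ := HardcoreTree.exists_rates hlam0 hb0 hq
    refine ⟨ζ₁, h₁, ζ₂, h₂, fun s => ?_⟩
    simp only [HardcoreTree.posterior_eq_post hlam0 hb0 hq ht,
      HardcoreTree.rootDensity_eq hlam0 hb0 ht, HardcoreTree.extremalMeasure_eq hlam0 hb0 ht]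
    exact h s
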